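/- Let $d\ge 1$, let $V_0$ be a real random variable and $\boldsymbol V=(V_1,\dots,V_d)$ a random vector on the same probability space, with exponential-tailed margins: $\mathbb P(V_l>v)\sim e^{-v}$ as $v\to\infty$, for $l=0,1,\dots,d$. Operations and inequalities between vectors are componentwise. Let $a_l,b_l:\mathbb R\to\mathbb R$ ($l=1,\dots,d$) be twice differentiable on a neighbourhood of $+\infty$, with $b_l>0$ there, and suppose that, as $v\to\infty$, $$a_l'(v)\to\alpha_l\in\mathbb R,\qquad a_l''(v)=o(1),\qquad b_l'(v)/b_l(v)=o(1).$$ Suppose that, for a version of the conditional law of $\boldsymbol V$ given $V_0$ and a function $G:\mathbb R^d\to\mathbb R$, for every $\boldsymbol z\in\mathbb R^d$, $$F_v(\boldsymbol z):=\mathbb P\left(\frac{\boldsymbol V-\boldsymbol a(V_0)}{\boldsymbol b(V_0)}\le \boldsymbol z\ \Big|\ V_0=v\right)\to G(\boldsymbol z),\qquad v\to\infty,$$ and that all first and second order partial derivatives converge as well: $G$ is twice partially differentiable on $\mathbb R^d$ and, for every $\boldsymbol z$ and all $k,l\in\{1,\dots,d\}$, $F_v$ has all first order partial derivatives near $\boldsymbol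 z$ and all second order ones at $\boldsymbol z$ for all large $v$, and $$\frac{\partial F_v}{\partial z_k}(\boldsymbol z)\to\frac{\partial G}{\partial z_k}(\boldsymbol z),\qquad \frac{\partial^2 F_v}{\partial z_k\partial z_l}(\boldsymbol z)\to\frac{\partial^2 G}{\partial z_k\partial z_l}(\boldsymbol z),\qquad v\to\infty.$$ Let $\lambda\in(0,1)$, let $Q\sim\mathrm{Exp}(1)$ be independent of $(V_0,\boldsymbol V)$, and put $X_0=V_0+\lambda Q+\log(1-\lambda)$ and $\boldsymbol X=\boldsymbol V+\lambda Q+\log(1-\lambda)$. Then there is a version of the conditional law of $\boldsymbol X$ given $X_0$ for which the following holds. (i) If $\min_{1\le l\le d}b_l(x)\to\infty$ as $x\to\infty$, then for every $\boldsymbol z\in\mathbb R^d$ $$\mathbb P\left(\frac{\boldsymbol X-\boldsymbol a(X_0)}{\boldsymbol b(X_0)}\le \boldsymbol z\ \Big|\ X_0=x\right)\to G(\boldsymbol z),\qquad x\to\infty.$$ (ii) Otherwise, if the limits $B_l=\lim_{x\to\infty}b_l(x)\in(0,\infty]$ exist, then for every $\boldsymbol z\in\mathbb R^d$ for which the limit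 $$q^\star=\lim_{x\to\infty}\left(\frac{-\log(1-\lambda)-v_*+\min\{\min_l(a_l(x)+b_l(x)z_l),\,x\}}{\lambda}\right)_+\in[0,\infty]$$ exists, $$\mathbb P\left(\frac{\boldsymbol X-\boldsymbol a(X_0)}{\boldsymbol b(X_0)}\le \boldsymbol z\ \Big|\ X_0=x\right)\to\int_0^{q^\star}G\left(\boldsymbol z+\frac{(\boldsymbol\alpha-1)(\lambda q+\log(1-\lambda))}{\boldsymbol B}\right)(1-\lambda)e^{-(1-\lambda)q}\,\mathrm dq,\qquad x\to\infty.$$ Here $\boldsymbol\alpha=(\alpha_1,\dots,\alpha_d)$, $\boldsymbol B=(B_1,\dots,B_d)$, division by $\infty$ gives $0$, and $v_*\in[-\infty,\infty)$ is the lower endpoint of the support of $(V_0,\dots,V_d)$, that is, the infimum of all $v$ with $\mathbb P(V_l\le v)>0$ for some $l\in\{0,\dots,d\}$ (the common lower endpoint if the margins are identical). -/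

import Mathlib

open MeasureTheory ProbabilityTheory Filter Topology Asymptotics

noncomputable section

/-- The partial derivative `∂F/∂z_k`, as a function of `z ∈ ℝ^d`. -/
def partialDeriv {d : ℕ} (k : Fin d) (F : (Fin d → ℝ) → ℝ) (z : Fin d → ℝ) : ℝ :=
  lineDeriv ℝ F z (Pi.single k 1)

/-- All first order partial derivatives of `F` exist near `z`, and all second order partial
derivatives of `F` exist at `z`. -/
def TwicePartiallyDifferentiableAt {d : ℕ} (F : (Fin d → ℝ) → ℝ) (z : Fin d → ℝ) : Prop :=
  (∀ k, ∀ᶠ y in 𝓝 z, LineDifferentiableAt ℝ F y (Pi.single k 1)) ∧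
    ∀ k l, LineDifferentiableAt ℝ (partialDeriv l F) z (Pi.single k 1)

/-- If `κ v` is the conditional law of a random vector `Y` given `Y₀ = v`, this is
`z ↦ ℙ((Y - a(Y₀)) / b(Y₀) ≤ z | Y₀ = v)`, with componentwise operations and order. -/
def normalizedCondCDF {d : ℕ} (κ : Kernel ℝ (Fin d → ℝ)) (a b : Fin d → ℝ → ℝ) (v : ℝ)
    (z : Fin d → ℝ) : ℝ :=
  (κ v).real {y | ∀ l, (y l - a l v) / b l v ≤ z l}

/-- Regularity of a pair of normalising functions: near `+∞` both are twice differentiable and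
`b > 0`; moreover `a' → α`, `a'' = o(1)` and `b' / b = o(1)`. -/
structure RegularNormalization (a b : ℝ → ℝ) (α : ℝ) : Prop where
  differentiable_a : ∀ᶠ v in atTop, DifferentiableAt ℝ a v ∧ DifferentiableAt ℝ (deriv a) v
  differentiable_b : ∀ᶠ v in atTop, DifferentiableAt ℝ b v ∧ DifferentiableAt ℝ (deriv b) v
  pos_b : ∀ᶠ v in atTop, 0 < b v
  tendsto_deriv_a : Tendsto (deriv a) atTop (𝓝 α)
  tendsto_deriv_deriv_a : Tendsto (deriv (deriv a)) atTop (𝓝 0)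
  tendsto_deriv_b_div : Tendsto (fun v => deriv b v / b v) atTop (𝓝 0)

/-- The functions `F v` converge pointwise to `G` as `v → ∞`, together with all first and second
order partial derivatives. -/
structure ConvergesWithPartials {d : ℕ} (F : ℝ → (Fin d → ℝ) → ℝ) (G : (Fin d → ℝ) → ℝ) :
    Prop where
  tendsto : ∀ z, Tendsto (fun v => F v z) atTop (𝓝 (G z))
  differentiable_limit : ∀ z, TwicePartiallyDifferentiableAt G z
  differentiable : ∀ z, ∀ᶠ v in atTop, TwicePartiallyDifferentiableAt (F v) z
  tendsto_first : ∀ z k,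
    Tendsto (fun v => partialDeriv k (F v) z) atTop (𝓝 (partialDeriv k G z))
  tendsto_second : ∀ z k l,
    Tendsto (fun v => partialDeriv k (partialDeriv l (F v)) z) atTop
      (𝓝 (partialDeriv k (partialDeriv l G) z))

/-- The lower endpoint `v_* ∈ [-∞, ∞)` of the support of `(V₀, V₁, …, V_d)`: the infimum of all
`v` such that some component is at most `v` with positive probability. If the components are
identically distributed, this is the lower endpoint of their common law. -/
def lowerEndpoint {Ω : Type*} [MeasurableSpace Ω] {d : ℕ} (P : Measure Ω) (V₀ : Ω → ℝ)
    (V : Ω → Fin d → ℝ) : EReal :=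
  sInf ((fun v : ℝ => (v : EReal)) ''
    {v : ℝ | 0 < P {ω | V₀ ω ≤ v} ∨ ∃ l, 0 < P {ω | V ω l ≤ v}})

/-- `([-log(1-λ) - v_* + min{min_l (a_l(x) + b_l(x) z_l), x}] / λ)₊`, an element of `[0, ∞]`. -/
def qBound {d : ℕ} (lam : ℝ) (vstar : EReal) (a b : Fin d → ℝ → ℝ) (z : Fin d → ℝ) (x : ℝ) :
    EReal :=
  max 0 ((((-Real.log (1 - lam) : ℝ) : EReal) - vstar
    + ((min (⨅ l, (a l x + b l x * z l)) x : ℝ) : EReal)) / (lam : EReal))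

/-- The vector `(α - 1)(λ q + log(1-λ)) / B` with `B ∈ (0, ∞]^d`; division by `∞` gives `0`. -/
def limitShift {d : ℕ} (lam : ℝ) (α : Fin d → ℝ) (B : Fin d → EReal) (q : ℝ) : Fin d → ℝ :=
  fun l => ((((α l - 1) * (lam * q + Real.log (1 - lam)) : ℝ) : EReal) / B l).toReal

end

noncomputable section

/-! ### Separately continuous monotone functions -/

/-! Write `c = log(1-λ)` and let `μ` be the law of `V₀`. By Bayes, given `X₀ = x` the law of `V₀` is
proportional to `e^{v/λ} 1{v ≤ x-c} μ(dv)`, and then `X = V + (x - V₀)` with `V` drawn from `κ V₀`.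
This gives an explicit version of the conditional law (`hasCondDistrib_mixtureKernel`), whose
normalised distribution function is an integral over the overshoot `q = (x-c-v)/λ`
(`normalizedCondCDF_mixtureKernel`).

Two limits are combined. The tail `e^{-v}` makes the tilted mass below `u` asymptotic to a constant
times `e^{u/λ-u}`, so the overshoot converges weakly to `Exp(1-λ)`
(`tendsto_overshootLaw_real_Ici`). The integrand is `F_v` at `v = x-c-λq` and at an argument tending
to `z + (α-1)(λq+c)β`, where `β = lim 1/b`. Monotonicity of `F_v` and separate continuity of `G`
make this convergence continuous in `q` (`tendsto_shifted_prob`), so the integrals converge too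
(`tendsto_integral_of_continuous_convergence`).

In case (i) `β = 0` and the integrand is the constant `G z`. In case (ii) the limit is an integral
over all `q ≥ 0`; truncating at `q*` changes nothing because the integrand vanishes beyond it
(`limit_eq_zero_of_eventually_le`): there the event forces some `V_l` below `v_*`. -/

lemma LineDifferentiableAt.tendsto_update {d : ℕ} {G : (Fin d → ℝ) → ℝ} {z : Fin d → ℝ}
    {k : Fin d} (h : LineDifferentiableAt ℝ G z (Pi.single k 1)) :
    Tendsto (fun t : ℝ => G (Function.update z k (z k + t))) (𝓝 0) (𝓝 (G z)) := by
  have hc : ContinuousAt (fun t : ℝ => G (z + t • Pi.single k (1 : ℝ))) 0 :=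
    DifferentiableAt.continuousAt h
  have h0 : Tendsto (fun t : ℝ => G (z + t • Pi.single k (1 : ℝ))) (𝓝 0) (𝓝 (G z)) := by
    simpa [ContinuousAt] using hc
  refine h0.congr fun t => congrArg G ?_
  ext i
  by_cases hi : i = k
  · subst hi; simp
  · simp [hi]

/-- Coordinates are raised one at a time, each by an amount small enough to keep `G` below `r`;
continuity along each axis suffices for this. -/
lemma exists_gt_image_lt_of_tendsto_update {d : ℕ} {G : (Fin d → ℝ) → ℝ}
    (hd : ∀ z k, Tendsto (fun t : ℝ => G (Function.update z k (z k + t))) (𝓝 0) (𝓝 (G z)))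
    (z : Fin d → ℝ) {r : ℝ} (hr : G z < r) : ∃ y, (∀ l, z l < y l) ∧ G y < r := by
  suffices H : ∀ s : Finset (Fin d), ∃ y, (∀ l ∈ s, z l < y l) ∧ (∀ l, z l ≤ y l) ∧ G y < r by
    obtain ⟨y, hy, -, hG⟩ := H Finset.univ
    exact ⟨y, fun l => hy l (Finset.mem_univ l), hG⟩
  intro s
  induction s using Finset.induction_on with
  | empty => exact ⟨z, by simp, fun _ => le_rfl, hr⟩
  | insert k s hk ih =>
    obtain ⟨y, hy, hzy, hG⟩ := ih
    have h1 : ∀ᶠ t in 𝓝[>] (0 : ℝ), G (Function.update y k (y k + t)) < r :=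
      ((hd y k).eventually (gt_mem_nhds hG)).filter_mono nhdsWithin_le_nhds
    obtain ⟨t, ht, ht0⟩ := (h1.and self_mem_nhdsWithin).exists
    have ht0 : 0 < t := ht0
    have hle : ∀ l, y l ≤ Function.update y k (y k + t) l := fun l => by
      by_cases hl : l = k
      · subst hl; simp [ht0.le]
      · simp [hl]
    refine ⟨_, fun l hl => ?_, fun l => (hzy l).trans (hle l), ht⟩
    rcases Finset.mem_insert.1 hl with rfl | hl
    · simpa using (hzy l).trans_lt (lt_add_of_pos_right _ ht0)
    · exact (hy l hl).trans_le (hle l)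

lemma exists_lt_lt_image_of_tendsto_update {d : ℕ} {G : (Fin d → ℝ) → ℝ}
    (hd : ∀ z k, Tendsto (fun t : ℝ => G (Function.update z k (z k + t))) (𝓝 0) (𝓝 (G z)))
    (z : Fin d → ℝ) {r : ℝ} (hr : r < G z) : ∃ y, (∀ l, y l < z l) ∧ r < G y := by
  -- The reflection `y ↦ -G (-y)` reduces the claim to the previous lemma.
  have hd' : ∀ z k, Tendsto (fun t : ℝ => -G (-(Function.update z k (z k + t)))) (𝓝 0)
      (𝓝 (-G (-z))) := fun z k => by
    have h0 : Tendsto (fun t : ℝ => -t) (𝓝 0) (𝓝 0) := by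
      simpa using (continuous_neg (G := ℝ)).tendsto 0
    refine ((hd (-z) k).comp h0).neg.congr fun t => ?_
    simp only [Function.comp]
    congr 2
    ext i
    by_cases hi : i = k
    · subst hi; simp; ring
    · simp [hi]
  obtain ⟨y, hy, hG⟩ := exists_gt_image_lt_of_tendsto_update (G := fun y => -G (-y)) hd' (-z)
    (r := -r) (by simpa using hr)
  exact ⟨-y, fun l => by have := hy l; simp at this ⊢; linarith, by linarith⟩

/-- Monotone functions converging pointwise to a separately continuous limit
converge continuously. -/
lemma tendsto_prod_nhds_of_monotone {d : ℕ} {F : ℝ → (Fin d → ℝ) → ℝ} {G : (Fin d → ℝ) → ℝ}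
    (hF : ∀ v, Monotone (F v)) (hFG : ∀ z, Tendsto (fun v => F v z) atTop (𝓝 (G z)))
    (hd : ∀ z k, Tendsto (fun t : ℝ => G (Function.update z k (z k + t))) (𝓝 0) (𝓝 (G z)))
    (z : Fin d → ℝ) :
    Tendsto (fun p : ℝ × (Fin d → ℝ) => F p.1 p.2) (atTop ×ˢ 𝓝 z) (𝓝 (G z)) := by
  refine tendsto_order.2 ⟨fun r hr => ?_, fun r hr => ?_⟩
  -- All points near `z` dominate `y`, so convergence at the single point `y` controls `F v` on a
  -- whole neighbourhood of `z`.
  · obtain ⟨y, hy, hG⟩ := exists_lt_lt_image_of_tendsto_update hd z hr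
    have h1 : ∀ᶠ ζ in 𝓝 z, ∀ l, y l < ζ l := eventually_all.2 fun l =>
      ((continuous_apply l).tendsto z).eventually (lt_mem_nhds (hy l))
    filter_upwards [((hFG y).eventually (lt_mem_nhds hG)).prod_mk h1] with p hp
    exact hp.1.trans_le (hF _ fun l => (hp.2 l).le)
  · obtain ⟨y, hy, hG⟩ := exists_gt_image_lt_of_tendsto_update hd z hr
    have h1 : ∀ᶠ ζ in 𝓝 z, ∀ l, ζ l < y l := eventually_all.2 fun l =>
      ((continuous_apply l).tendsto z).eventually (gt_mem_nhds (hy l))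
    filter_upwards [((hFG y).eventually (gt_mem_nhds hG)).prod_mk h1] with p hp
    exact (hF _ fun l => (hp.2 l).le).trans_lt hp.1

lemma continuous_of_monotone_of_tendsto_update {d : ℕ} {G : (Fin d → ℝ) → ℝ} (hG : Monotone G)
    (hd : ∀ z k, Tendsto (fun t : ℝ => G (Function.update z k (z k + t))) (𝓝 0) (𝓝 (G z))) :
    Continuous G := continuous_iff_continuousAt.2 fun z => by
  have h := tendsto_prod_nhds_of_monotone (F := fun _ => G) (fun _ => hG)
    (fun _ => tendsto_const_nhds) hd z
  have h2 : Tendsto (G ∘ Prod.snd) ((atTop : Filter ℝ) ×ˢ 𝓝 z) (𝓝 (G z)) := h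
  rwa [← tendsto_map'_iff, map_snd_prod] at h2

/-! ### Increments of regular normalising functions -/

/-- If `f' → m` at infinity, then `f x - f (x - s) → m s`, continuously in `s`. -/
lemma tendsto_sub_comp_sub_of_tendsto_deriv {f : ℝ → ℝ} {m : ℝ}
    (hf : ∀ᶠ v in atTop, DifferentiableAt ℝ f v) (hm : Tendsto (deriv f) atTop (𝓝 m)) (s : ℝ) :
    Tendsto (fun p : ℝ × ℝ => f p.1 - f (p.1 - p.2)) (atTop ×ˢ 𝓝 s) (𝓝 (m * s)) := by
  have hs : Tendsto (fun p : ℝ × ℝ => m * p.2) (atTop ×ˢ 𝓝 s) (𝓝 (m * s)) :=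
    tendsto_snd.const_mul m
  suffices H : Tendsto (fun p : ℝ × ℝ => f p.1 - f (p.1 - p.2) - m * p.2) (atTop ×ˢ 𝓝 s) (𝓝 0) by
    simpa using H.add hs
  rw [Metric.tendsto_nhds]
  intro ε hε
  set δ := ε / (|s| + 2) with hδ
  have hs2 : 0 < |s| + 2 := by positivity
  have hδ0 : 0 < δ := by positivity
  have hd : ∀ᶠ v in atTop, dist (deriv f v) m < δ := hm.eventually (Metric.ball_mem_nhds m hδ0)
  obtain ⟨K, hK⟩ := eventually_atTop.1 (hf.and hd)
  have hsn : ∀ᶠ t in 𝓝 s, |t| < |s| + 1 :=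
    (continuous_abs.tendsto s).eventually (gt_mem_nhds (by linarith))
  filter_upwards [(eventually_ge_atTop (K + (|s| + 1))).prod_mk hsn] with p hp
  -- Both endpoints lie beyond `K`, where `f t - m t` has derivative at most `δ` in absolute value;
  -- the mean value inequality applies between them.
  obtain ⟨hp1, hp2⟩ := hp
  have hx : p.1 ∈ Set.Ici K := by
    have := abs_nonneg s; simp only [Set.mem_Ici]; linarith
  have hv : p.1 - p.2 ∈ Set.Ici K := by
    have := le_abs_self p.2; simp only [Set.mem_Ici]; linarith
  have key := (convex_Ici K).norm_image_sub_le_of_norm_hasDerivWithin_le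
    (f := fun t => f t - m * t) (f' := fun t => deriv f t - m) (C := δ)
    (fun t ht => (((hK t ht).1.hasDerivAt).sub
      (by simpa using (hasDerivAt_id t).const_mul m)).hasDerivWithinAt)
    (fun t ht => by simpa [Real.dist_eq] using (hK t ht).2.le) hv hx
  rw [Real.dist_eq, sub_zero]
  calc |f p.1 - f (p.1 - p.2) - m * p.2|
      = ‖f p.1 - m * p.1 - (f (p.1 - p.2) - m * (p.1 - p.2))‖ := by
        rw [Real.norm_eq_abs]; congr 1; ring
    _ ≤ δ * ‖p.1 - (p.1 - p.2)‖ := key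
    _ = δ * |p.2| := by rw [Real.norm_eq_abs]; congr 2; ring
    _ < δ * (|s| + 2) := by gcongr; linarith
    _ = ε := by rw [hδ]; field_simp

lemma tendsto_fst_sub_snd_atTop (s : ℝ) :
    Tendsto (fun p : ℝ × ℝ => p.1 - p.2) (atTop ×ˢ 𝓝 s) atTop := by
  simpa [sub_eq_add_neg] using
    tendsto_fst.atTop_add (C := -s) (tendsto_snd.neg : Tendsto (fun p : ℝ × ℝ => -p.2)
      (atTop ×ˢ 𝓝 s) (𝓝 (-s)))

/-- The increment lemma applies to `log b`, whose derivative `b'/b` tends to `0`. -/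
lemma RegularNormalization.tendsto_div {a b : ℝ → ℝ} {α : ℝ} (h : RegularNormalization a b α)
    (s : ℝ) :
    Tendsto (fun p : ℝ × ℝ => b p.1 / b (p.1 - p.2)) (atTop ×ˢ 𝓝 s) (𝓝 1) := by
  have hlog : Tendsto (fun p : ℝ × ℝ => Real.log (b p.1) - Real.log (b (p.1 - p.2)))
      (atTop ×ˢ 𝓝 s) (𝓝 (0 * s)) := by
    refine tendsto_sub_comp_sub_of_tendsto_deriv (f := fun v => Real.log (b v)) ?_ ?_ s
    · filter_upwards [h.differentiable_b, h.pos_b] with v h1 h2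
      exact h1.1.log h2.ne'
    · refine h.tendsto_deriv_b_div.congr' ?_
      filter_upwards [h.differentiable_b, h.pos_b] with v h1 h2
      exact (deriv.log h1.1 h2.ne').symm
  have h2 := (Real.continuous_exp.tendsto _).comp hlog
  rw [zero_mul, Real.exp_zero] at h2
  refine h2.congr' ?_
  filter_upwards [tendsto_fst.eventually h.pos_b,
    (tendsto_fst_sub_snd_atTop s).eventually h.pos_b] with p hp1 hp2
  simp only [Function.comp]
  rw [Real.exp_sub, Real.exp_log hp1, Real.exp_log hp2]

/-- The normalised argument obtained after shifting `x` to `x - s`. -/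
lemma RegularNormalization.tendsto_shifted_argument {a b : ℝ → ℝ} {α β : ℝ}
    (h : RegularNormalization a b α) (hβ : Tendsto (fun x => (b x)⁻¹) atTop (𝓝 β)) (ζ s : ℝ) :
    Tendsto (fun p : ℝ × ℝ => (a p.1 + b p.1 * ζ - p.2 - a (p.1 - p.2)) / b (p.1 - p.2))
      (atTop ×ˢ 𝓝 s) (𝓝 (ζ + (α - 1) * s * β)) := by
  have h1 := tendsto_sub_comp_sub_of_tendsto_deriv
    (h.differentiable_a.mono fun v hv => hv.1) h.tendsto_deriv_a s
  -- The argument splits as `(b x / b (x-s)) ζ + (a x - a (x-s) - s) / b (x-s)`.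
  have h2 := (((h.tendsto_div s).mul_const ζ).add
    ((h1.sub tendsto_snd).mul (hβ.comp (tendsto_fst_sub_snd_atTop s))))
  have e : ζ + (α - 1) * s * β = 1 * ζ + (α * s - s) * β := by ring
  rw [e]
  refine h2.congr fun p => ?_
  simp only [Function.comp, div_eq_mul_inv]
  ring

/-! ### Integrals against weakly convergent measures -/

/-- If `h x → g` continuously, `g` is continuous and everything is bounded by one, then
integrals against weakly convergent probability measures converge. -/
lemma tendsto_integral_of_continuous_convergence {ν : ℝ → ProbabilityMeasure ℝ}
    {ν₀ : ProbabilityMeasure ℝ} (hν : Tendsto ν atTop (𝓝 ν₀)) {h : ℝ → ℝ → ℝ} {g : ℝ → ℝ}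
    (hm : ∀ x, Measurable (h x)) (hb : ∀ x q, |h x q| ≤ 1) (hg : Continuous g)
    (hconv : ∀ q, Tendsto (fun p : ℝ × ℝ => h p.1 p.2) (atTop ×ˢ 𝓝 q) (𝓝 (g q))) :
    Tendsto (fun x => ∫ q, h x q ∂(ν x : Measure ℝ)) atTop (𝓝 (∫ q, g q ∂(ν₀ : Measure ℝ))) := by
  have hgb : ∀ q, |g q| ≤ 1 := fun q =>
    le_of_tendsto (hconv q).abs (Eventually.of_forall fun p => hb _ _)
  have hunif : TendstoLocallyUniformly h g atTop :=
    tendstoLocallyUniformly_iff_forall_tendsto.2 fun q =>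
      tendsto_uniformity_iff_dist_tendsto_zero.2 <| by
        have := ((hg.tendsto q).comp (tendsto_snd (f := (atTop : Filter ℝ)))).dist (hconv q)
        simpa using this
  have hgi : Tendsto (fun x => ∫ q, g q ∂(ν x : Measure ℝ)) atTop
      (𝓝 (∫ q, g q ∂(ν₀ : Measure ℝ))) :=
    (ProbabilityMeasure.tendsto_iff_forall_integral_tendsto.1 hν)
      (BoundedContinuousFunction.ofNormedAddCommGroup g hg 1 hgb)
  suffices H : Tendsto (fun x => ∫ q, (h x q - g q) ∂(ν x : Measure ℝ)) atTop (𝓝 0) by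
    have h1 := H.add hgi
    rw [zero_add] at h1
    refine h1.congr fun x => ?_
    rw [integral_sub, sub_add_cancel]
    · exact Integrable.of_bound (hm x).aestronglyMeasurable 1 (ae_of_all _ (hb x))
    · exact Integrable.of_bound hg.aestronglyMeasurable 1 (ae_of_all _ hgb)
  -- a continuous cutoff controlling the tails
  let χ : ℕ → ℝ → ℝ := fun n q => min 1 (|q| / n)
  have hχc : ∀ n, Continuous (χ n) := fun n =>
    continuous_const.min (continuous_abs.div_const _)
  have hχ0 : ∀ n q, 0 ≤ χ n q := fun n q => le_min zero_le_one (by positivity)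
  have hχ1 : ∀ n q, ‖χ n q‖ ≤ 1 := fun n q => by
    rw [Real.norm_of_nonneg (hχ0 n q)]; exact min_le_left _ _
  have hχi : ∀ n (m : Measure ℝ) [IsFiniteMeasure m], Integrable (χ n) m := fun n m _ =>
    Integrable.of_bound (hχc n).aestronglyMeasurable 1 (ae_of_all _ (hχ1 n))
  have hχlim : Tendsto (fun n => ∫ q, χ n q ∂(ν₀ : Measure ℝ)) atTop (𝓝 0) := by
    have h1 : ∀ q, Tendsto (fun n => χ n q) atTop (𝓝 0) := fun q => by
      have h2 : Tendsto (fun n : ℕ => |q| / n) atTop (𝓝 0) :=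
        tendsto_const_nhds.div_atTop tendsto_natCast_atTop_atTop
      simpa using (tendsto_const_nhds (x := (1 : ℝ))).min h2
    simpa using tendsto_integral_of_dominated_convergence (fun _ => (1 : ℝ))
      (fun n => (hχc n).aestronglyMeasurable) (integrable_const _)
      (fun n => ae_of_all _ (hχ1 n)) (ae_of_all _ h1)
  rw [Metric.tendsto_nhds]
  intro ε hε
  -- Positivity of `n` matters: `χ 0` is identically `0`, since division by zero gives `0`, and cuts
  -- nothing off.
  obtain ⟨n, hn, hn0⟩ := ((hχlim.eventually (gt_mem_nhds (show 0 < ε / 4 by positivity))).and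
    (eventually_gt_atTop 0)).exists
  have hn0 : (0 : ℝ) < n := by exact_mod_cast hn0
  have hχx : ∀ᶠ x in atTop, ∫ q, χ n q ∂(ν x : Measure ℝ) < ε / 4 :=
    ((ProbabilityMeasure.tendsto_iff_forall_integral_tendsto.1 hν)
      (BoundedContinuousFunction.ofNormedAddCommGroup (χ n) (hχc n) 1 (hχ1 n))).eventually
      (gt_mem_nhds hn)
  have hu : ∀ᶠ x in atTop, ∀ q ∈ Set.Icc (-n : ℝ) n, dist (g q) (h x q) < ε / 2 :=
    Metric.tendstoUniformlyOn_iff.1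
      ((tendstoLocallyUniformlyOn_iff_tendstoUniformlyOn_of_compact isCompact_Icc).1
        hunif.tendstoLocallyUniformlyOn) _ (half_pos hε)
  filter_upwards [hχx, hu] with x hx1 hx2
  rw [dist_zero_right]
  -- Uniform closeness is used on `[-n, n]`; outside, `χ n = 1` absorbs the trivial bound `2`.
  have hbound : ∀ q, ‖h x q - g q‖ ≤ ε / 2 + 2 * χ n q := fun q => by
    by_cases hq : q ∈ Set.Icc (-n : ℝ) n
    · have h1 := hx2 q hq
      rw [dist_comm, Real.dist_eq] at h1
      rw [Real.norm_eq_abs]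
      linarith [hχ0 n q]
    · have hq1 : (n : ℝ) ≤ |q| := by
        by_contra hlt
        exact hq (abs_le.1 (not_le.1 hlt).le)
      have h1 : χ n q = 1 := min_eq_left ((one_le_div hn0).2 hq1)
      rw [h1]
      have h2 := norm_sub_le (h x q) (g q)
      have h3 := hb x q
      have h4 := hgb q
      simp only [Real.norm_eq_abs] at h2 ⊢
      linarith
  calc ‖∫ q, (h x q - g q) ∂(ν x : Measure ℝ)‖
      ≤ ∫ q, (ε / 2 + 2 * χ n q) ∂(ν x : Measure ℝ) :=
        norm_integral_le_of_norm_le ((integrable_const _).add ((hχi n _).const_mul 2))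
          (ae_of_all _ hbound)
    _ = ε / 2 + 2 * ∫ q, χ n q ∂(ν x : Measure ℝ) := by
        rw [integral_add (integrable_const _) ((hχi n _).const_mul 2), integral_const_mul]
        simp
    _ < ε := by linarith

/-- Convergence of the masses of all half-lines `[t, ∞)` implies weak convergence. -/
lemma tendsto_probabilityMeasure_of_tendsto_Ici {ν : ℝ → ProbabilityMeasure ℝ}
    {ν₀ : ProbabilityMeasure ℝ}
    (h : ∀ t, Tendsto (fun x => (ν x : Measure ℝ).real (Set.Ici t)) atTop
      (𝓝 ((ν₀ : Measure ℝ).real (Set.Ici t)))) :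
    Tendsto ν atTop (𝓝 ν₀) := by
  -- Intervals `[a, b)` form a π-system containing arbitrarily small neighbourhoods of each point,
  -- and their masses are differences of half-line masses.
  refine IsPiSystem.tendsto_probabilityMeasure_of_tendsto_of_mem
    (S := {s | ∃ a b : ℝ, a < b ∧ Set.Ico a b = s}) ?_ ?_ ?_ ?_
  · rintro s ⟨a, b, -, rfl⟩ t ⟨a', b', -, rfl⟩ ⟨x, hx⟩
    refine ⟨max a a', min b b', ?_, Set.Ico_inter_Ico.symm⟩
    rw [Set.Ico_inter_Ico] at hx
    exact hx.1.trans_lt hx.2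
  · rintro s ⟨a, b, -, rfl⟩
    exact measurableSet_Ico
  · intro u hu x hx
    obtain ⟨ε, hε, hε'⟩ := Metric.isOpen_iff.1 hu x hx
    refine ⟨Set.Ico (x - ε / 2) (x + ε / 2), ⟨_, _, by linarith, rfl⟩,
      Ico_mem_nhds (by linarith) (by linarith), fun y hy => hε' ?_⟩
    rw [Metric.mem_ball, Real.dist_eq, abs_lt]
    constructor <;> linarith [hy.1, hy.2]
  · rintro s ⟨a, b, hab, rfl⟩
    have e : ∀ m : ProbabilityMeasure ℝ, ((m (Set.Ico a b) : NNReal) : ℝ) =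
        (m : Measure ℝ).real (Set.Ici a) - (m : Measure ℝ).real (Set.Ici b) := fun m => by
      rw [← measureReal_sdiff (Set.Ici_subset_Ici.2 hab.le) measurableSet_Ici, Set.Ici_sdiff_Ici]
      rfl
    rw [← NNReal.tendsto_coe]
    simp only [e]
    exact (h a).sub (h b)

/-! ### Exponential tilting below a threshold -/

/-- The weight `e^{v/λ} 1{v ≤ u}`. -/
def tiltWeight (lam u v : ℝ) : ENNReal :=
  if v ≤ u then ENNReal.ofReal (Real.exp (v / lam)) else 0

/-- The total mass of `e^{v/λ} 1{v ≤ u} μ(dv)`. -/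
def tiltMass (μ : Measure ℝ) (lam u : ℝ) : ENNReal := ∫⁻ v, tiltWeight lam u v ∂μ

lemma measurable_tiltWeight (lam : ℝ) : Measurable fun p : ℝ × ℝ => tiltWeight lam p.1 p.2 :=
  Measurable.ite (measurableSet_le measurable_snd measurable_fst) (by fun_prop) measurable_const

lemma measurable_tiltWeight_right (lam u : ℝ) : Measurable (tiltWeight lam u) :=
  (measurable_tiltWeight lam).comp measurable_prodMk_left

lemma measurable_tiltMass (μ : Measure ℝ) [SFinite μ] (lam : ℝ) : Measurable (tiltMass μ lam) :=
  (measurable_tiltWeight lam).lintegral_prod_right'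

lemma tiltMass_ne_top (μ : Measure ℝ) [IsFiniteMeasure μ] {lam : ℝ} (hlam : 0 < lam) (u : ℝ) :
    tiltMass μ lam u ≠ ⊤ := by
  have h : tiltMass μ lam u ≤ ∫⁻ _, ENNReal.ofReal (Real.exp (u / lam)) ∂μ := by
    refine lintegral_mono fun v => ?_
    rw [tiltWeight]
    split_ifs with hv
    · exact ENNReal.ofReal_le_ofReal (Real.exp_le_exp.2 (by gcongr))
    · exact zero_le
  refine (h.trans_lt ?_).ne
  rw [lintegral_const]
  exact ENNReal.mul_lt_top ENNReal.ofReal_lt_top (measure_lt_top _ _)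

/-- The normalised tilted law `∝ e^{v/λ} 1{v ≤ u} μ(dv)`, as a kernel in `u`. -/
def tiltKernel (μ : Measure ℝ) [IsFiniteMeasure μ] (lam : ℝ) : Kernel ℝ ℝ :=
  haveI : DecidablePred (· ∈ tiltMass μ lam ⁻¹' {0}ᶜ) := Classical.decPred _
  Kernel.piecewise (s := tiltMass μ lam ⁻¹' {0}ᶜ)
    ((measurable_tiltMass μ lam) (measurableSet_singleton 0).compl)
    ((Kernel.const ℝ μ).withDensity fun u v => (tiltMass μ lam u)⁻¹ * tiltWeight lam u v)
    -- An arbitrary probability measure where the mass vanishes, so that the kernel is Markov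
    -- everywhere.
    (Kernel.const ℝ (Measure.dirac 0))

lemma lintegral_tiltKernel (μ : Measure ℝ) [IsFiniteMeasure μ] {lam u : ℝ}
    (hu : tiltMass μ lam u ≠ 0) {f : ℝ → ENNReal} (hf : Measurable f) :
    ∫⁻ v, f v ∂(tiltKernel μ lam u) =
      (tiltMass μ lam u)⁻¹ * ∫⁻ v, tiltWeight lam u v * f v ∂μ := by
  classical
  have hm : Measurable (Function.uncurry fun u v =>
      (tiltMass μ lam u)⁻¹ * tiltWeight lam u v) :=
    (((measurable_tiltMass μ lam).comp measurable_fst).inv).mul (measurable_tiltWeight lam)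
  rw [tiltKernel, Kernel.lintegral_piecewise, if_pos (by simpa using hu),
    Kernel.lintegral_withDensity _ hm _ hf, Kernel.const_apply]
  simp only [mul_assoc]
  exact lintegral_const_mul _ ((measurable_tiltWeight_right lam u).mul hf)

/-- In this multiplied form no nonvanishing is needed: if the mass is zero, the weight is zero
`μ`-almost everywhere. -/
lemma tiltMass_mul_lintegral_tiltKernel (μ : Measure ℝ) [IsFiniteMeasure μ] {lam : ℝ}
    (hlam : 0 < lam) (u : ℝ) {f : ℝ → ENNReal} (hf : Measurable f) :
    tiltMass μ lam u * ∫⁻ v, f v ∂(tiltKernel μ lam u) = ∫⁻ v, tiltWeight lam u v * f v ∂μ := by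
  by_cases hu : tiltMass μ lam u = 0
  · rw [hu, zero_mul]
    have h0 := (lintegral_eq_zero_iff (measurable_tiltWeight_right lam u)).1 hu
    refine (lintegral_eq_zero_of_ae_eq_zero ?_).symm
    filter_upwards [h0] with v hv
    simp [hv]
  · rw [lintegral_tiltKernel μ hu hf, ← mul_assoc,
      ENNReal.mul_inv_cancel hu (tiltMass_ne_top μ hlam u), one_mul]

lemma isMarkovKernel_tiltKernel (μ : Measure ℝ) [IsFiniteMeasure μ] {lam : ℝ} (hlam : 0 < lam) :
    IsMarkovKernel (tiltKernel μ lam) := by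
  classical
  refine ⟨fun u => ⟨?_⟩⟩
  by_cases hu : tiltMass μ lam u = 0
  · rw [tiltKernel, Kernel.piecewise_apply, if_neg (by simpa using hu), Kernel.const_apply]
    exact measure_univ
  · rw [← lintegral_one, lintegral_tiltKernel μ hu measurable_const]
    simp only [mul_one]
    exact ENNReal.inv_mul_cancel hu (tiltMass_ne_top μ hlam u)

lemma tiltKernel_absolutelyContinuous (μ : Measure ℝ) [IsFiniteMeasure μ] {lam u : ℝ}
    (hu : tiltMass μ lam u ≠ 0) : tiltKernel μ lam u ≪ μ := by
  classical
  rw [tiltKernel, Kernel.piecewise_apply, if_pos (by simpa using hu)]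
  exact Kernel.withDensity_absolutelyContinuous _ _

/-- The tilted mass as a Bochner integral. -/
lemma tiltMass_eq_ofReal (μ : Measure ℝ) [IsFiniteMeasure μ] {lam : ℝ} (hlam : 0 < lam) (u : ℝ) :
    tiltMass μ lam u = ENNReal.ofReal
      (Real.exp (u / lam) * ∫ v in Set.Iic u, Real.exp ((v - u) / lam) ∂μ) := by
  have hi : IntegrableOn (fun v => Real.exp ((v - u) / lam)) (Set.Iic u) μ := by
    refine Integrable.of_bound (by fun_prop) 1 ?_
    filter_upwards [ae_restrict_mem measurableSet_Iic] with v hv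
    rw [Real.norm_of_nonneg (Real.exp_pos _).le, Real.exp_le_one_iff]
    exact div_nonpos_of_nonpos_of_nonneg (sub_nonpos.2 hv) hlam.le
  rw [← integral_const_mul, ofReal_integral_eq_lintegral_ofReal (hi.const_mul _)
    (ae_of_all _ fun v => by positivity), tiltMass, ← lintegral_indicator measurableSet_Iic]
  refine lintegral_congr fun v => ?_
  rw [tiltWeight, Set.indicator_apply]
  simp only [Set.mem_Iic]
  split_ifs with hv
  · rw [← Real.exp_add]; congr 2; ring
  · rfl

/-! ### Asymptotics of the tilted mass -/

lemma tendsto_exp_mul_tail {T : ℝ → ℝ} (hT : T ~[atTop] fun v => Real.exp (-v)) :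
    Tendsto (fun v => Real.exp v * T v) atTop (𝓝 1) := by
  have h := (isEquivalent_iff_tendsto_one (Eventually.of_forall fun v => (Real.exp_pos _).ne')).1 hT
  refine h.congr fun v => ?_
  simp only [Pi.div_apply, Real.exp_neg]
  field_simp

/-- The asymptotics bound the product by `2` beyond some `K`; below `K` it is at most `e^K`. This
global bound supplies the domination used for the tilted mass. -/
lemma exists_tail_le_mul_exp (μ : Measure ℝ) [IsProbabilityMeasure μ]
    (hμ : (fun v => μ.real (Set.Ioi v)) ~[atTop] fun v => Real.exp (-v)) :
    ∃ C, 0 ≤ C ∧ ∀ v, Real.exp v * μ.real (Set.Ioi v) ≤ C := by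
  obtain ⟨K, hK⟩ := eventually_atTop.1
    ((tendsto_exp_mul_tail hμ).eventually (gt_mem_nhds (show (1 : ℝ) < 2 by norm_num)))
  refine ⟨max 2 (Real.exp K), by positivity, fun v => ?_⟩
  rcases le_total K v with hv | hv
  · exact (hK v hv).le.trans (le_max_left _ _)
  · refine le_trans ?_ (le_max_right _ _)
    calc Real.exp v * μ.real (Set.Ioi v) ≤ Real.exp v * 1 := by
          gcongr; exact measureReal_le_one
      _ ≤ Real.exp K := by simpa using hv

/-- Layer-cake formula: on `v ≤ u` the integrand lies in `(0, 1]`, and it exceeds `r` exactly when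
`v > u + λ log r`. -/
lemma integral_exp_Iic_eq (μ : Measure ℝ) [IsProbabilityMeasure μ] {lam : ℝ} (hlam : 0 < lam)
    (u : ℝ) : ∫ v in Set.Iic u, Real.exp ((v - u) / lam) ∂μ =
      ∫ r in Set.Ioo (0 : ℝ) 1,
        (μ.real (Set.Ioi (u + lam * Real.log r)) - μ.real (Set.Ioi u)) := by
  have hi : Integrable (fun v => Real.exp ((v - u) / lam)) (μ.restrict (Set.Iic u)) := by
    refine Integrable.of_bound (by fun_prop) 1 ?_
    filter_upwards [ae_restrict_mem measurableSet_Iic] with v hv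
    rw [Real.norm_of_nonneg (Real.exp_pos _).le, Real.exp_le_one_iff]
    exact div_nonpos_of_nonpos_of_nonneg (sub_nonpos.2 hv) hlam.le
  have hset : ∀ r : ℝ, 0 < r → {v | r < Real.exp ((v - u) / lam)} =
      Set.Ioi (u + lam * Real.log r) := fun r hr => by
    ext v
    simp only [Set.mem_ofPred_eq, Set.mem_Ioi]
    rw [← Real.log_lt_iff_lt_exp hr, lt_div_iff₀ hlam]
    constructor <;> intro h <;> linarith
  rw [hi.integral_eq_integral_meas_lt (ae_of_all _ fun v => (Real.exp_pos _).le)]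
  rw [setIntegral_eq_of_subset_of_forall_sdiff_eq_zero measurableSet_Ioi
    (s := Set.Ioo (0 : ℝ) 1) Set.Ioo_subset_Ioi_self]
  · refine setIntegral_congr_fun measurableSet_Ioo fun r hr => ?_
    have hle : u + lam * Real.log r ≤ u := by
      have := Real.log_neg hr.1 hr.2; nlinarith
    rw [hset r hr.1, measureReal_restrict_apply measurableSet_Ioi,
      ← measureReal_sdiff (Set.Ioi_subset_Ioi hle) measurableSet_Ioi]
    congr 1
    ext v
    simp
  · rintro r ⟨hr0, hr1⟩
    have hr0 : 0 < r := hr0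
    have hr1 : 1 ≤ r := by
      by_contra h
      exact hr1 ⟨hr0, not_le.1 h⟩
    have hle : u ≤ u + lam * Real.log r := by
      have := Real.log_nonneg hr1; nlinarith
    rw [hset r hr0, measureReal_restrict_apply measurableSet_Ioi]
    have : Set.Ioi (u + lam * Real.log r) ∩ Set.Iic u = ∅ := by
      ext v
      simp only [Set.mem_inter_iff, Set.mem_Ioi, Set.mem_Iic, Set.mem_empty_iff_false, iff_false]
      rintro ⟨h1, h2⟩
      linarith
    rw [this, measureReal_empty]

lemma exists_tendsto_exp_mul_integral_Iic (μ : Measure ℝ) [IsProbabilityMeasure μ] {lam : ℝ}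
    (hlam : lam ∈ Set.Ioo (0 : ℝ) 1)
    (hμ : (fun v => μ.real (Set.Ioi v)) ~[atTop] fun v => Real.exp (-v)) :
    ∃ L, 0 < L ∧ Tendsto (fun u => Real.exp u *
      ∫ v in Set.Iic u, Real.exp ((v - u) / lam) ∂μ) atTop (𝓝 L) := by
  obtain ⟨C, hC0, hC⟩ := exists_tail_le_mul_exp μ hμ
  have hint : IntegrableOn (fun r : ℝ => r ^ (-lam)) (Set.Ioo 0 1) := by
    rw [← intervalIntegrable_iff_integrableOn_Ioo_of_le zero_le_one]
    exact intervalIntegral.intervalIntegrable_rpow' (by linarith [hlam.2])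
  -- After the layer-cake formula, `e^u` times the tail at `u + λ log r` tends to `r^{-λ}` and is at
  -- most `C r^{-λ}`, integrable because `λ < 1`. The limit equals `1/(1-λ) - 1 > 0`.
  refine ⟨∫ r in Set.Ioo (0 : ℝ) 1, (r ^ (-lam) - 1), ?_, ?_⟩
  · rw [← integral_Ioc_eq_integral_Ioo, ← intervalIntegral.integral_of_le zero_le_one,
      intervalIntegral.integral_sub
        (intervalIntegral.intervalIntegrable_rpow' (by linarith [hlam.2])) (by simp),
      integral_rpow (Or.inl (by linarith [hlam.2]))]
    have h1 : 0 < -lam + 1 := by linarith [hlam.2]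
    have h2 : -lam + 1 < 1 := by linarith [hlam.1]
    simp only [Real.one_rpow, Real.zero_rpow h1.ne', intervalIntegral.integral_const]
    have := one_lt_one_div h1 h2
    simp at this ⊢
    linarith
  · simp_rw [integral_exp_Iic_eq μ hlam.1, ← integral_const_mul]
    have hexp : ∀ u r : ℝ, 0 < r → Real.exp u = r ^ (-lam) * Real.exp (u + lam * Real.log r) :=
      fun u r hr => by
        rw [Real.rpow_def_of_pos hr, ← Real.exp_add]; congr 1; ring
    refine tendsto_integral_filter_of_dominated_convergence (fun r => C * r ^ (-lam)) ?_ ?_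
      (hint.const_mul C) ?_
    · refine Eventually.of_forall fun u => Measurable.aestronglyMeasurable ?_
      have hanti : Antitone fun t => μ.real (Set.Ioi t) := fun s t hst =>
        measureReal_mono (Set.Ioi_subset_Ioi hst)
      exact ((hanti.measurable.comp (by fun_prop)).sub measurable_const).const_mul _
    · refine Eventually.of_forall fun u => ?_
      filter_upwards [ae_restrict_mem measurableSet_Ioo] with r hr
      have hle : u + lam * Real.log r ≤ u := by
        have := Real.log_neg hr.1 hr.2; nlinarith [hlam.1]
      have h1 : 0 ≤ μ.real (Set.Ioi (u + lam * Real.log r)) - μ.real (Set.Ioi u) :=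
        sub_nonneg.2 (measureReal_mono (Set.Ioi_subset_Ioi hle))
      rw [Real.norm_of_nonneg (by positivity)]
      calc Real.exp u * (μ.real (Set.Ioi (u + lam * Real.log r)) - μ.real (Set.Ioi u))
          ≤ Real.exp u * μ.real (Set.Ioi (u + lam * Real.log r)) := by
            gcongr; linarith [measureReal_nonneg (μ := μ) (s := Set.Ioi u)]
        _ = r ^ (-lam) * (Real.exp (u + lam * Real.log r) *
              μ.real (Set.Ioi (u + lam * Real.log r))) := by
            rw [hexp u r hr.1]; ring
        _ ≤ r ^ (-lam) * C := by
            have := Real.rpow_nonneg hr.1.le (-lam)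
            gcongr
            exact hC _
        _ = C * r ^ (-lam) := mul_comm _ _
    · filter_upwards [ae_restrict_mem measurableSet_Ioo] with r hr
      have h1 := tendsto_exp_mul_tail hμ
      have h2 := (h1.comp (tendsto_atTop_add_const_right atTop (lam * Real.log r)
        tendsto_id)).const_mul (r ^ (-lam))
      rw [mul_one] at h2
      refine (h2.sub h1).congr fun u => ?_
      simp only [Function.comp, id]
      rw [mul_sub, ← mul_assoc, ← hexp u r hr.1]

/-- The law of `(u - v) / λ`, where `v` follows the tilted law at `u`. -/
def overshootLaw (μ : Measure ℝ) [IsFiniteMeasure μ] (lam u : ℝ) : Measure ℝ :=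
  (tiltKernel μ lam u).map fun v => (u - v) / lam

/-- The overshoot is at least `t` exactly when `v ≤ u - λt`, which merely lowers the truncation
level. -/
lemma overshootLaw_real_Ici (μ : Measure ℝ) [IsProbabilityMeasure μ] {lam : ℝ} (hlam : 0 < lam)
    {u t : ℝ} (ht : 0 ≤ t) (hu : tiltMass μ lam u ≠ 0) :
    (overshootLaw μ lam u).real (Set.Ici t) =
      (tiltMass μ lam (u - lam * t)).toReal / (tiltMass μ lam u).toReal := by
  have hpre : (fun v => (u - v) / lam) ⁻¹' Set.Ici t = Set.Iic (u - lam * t) := by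
    ext v
    simp only [Set.mem_preimage, Set.mem_Ici, Set.mem_Iic, le_div_iff₀ hlam]
    constructor <;> intro h <;> linarith
  rw [overshootLaw, map_measureReal_apply (by fun_prop) measurableSet_Ici, hpre, measureReal_def,
    ← lintegral_indicator_one measurableSet_Iic,
    lintegral_tiltKernel μ hu (measurable_one.indicator measurableSet_Iic), ENNReal.toReal_mul,
    ENNReal.toReal_inv, div_eq_inv_mul]
  congr 2
  rw [tiltMass]
  refine lintegral_congr fun v => ?_
  have : lam * t ≥ 0 := by positivity
  simp only [tiltWeight, Set.indicator_apply, Set.mem_Iic, Pi.one_apply]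
  by_cases h1 : v ≤ u - lam * t
  · have h2 : v ≤ u := by linarith
    simp [h1, h2]
  · simp [h1]

lemma isProbabilityMeasure_overshootLaw (μ : Measure ℝ) [IsFiniteMeasure μ] {lam : ℝ}
    (hlam : 0 < lam) (u : ℝ) : IsProbabilityMeasure (overshootLaw μ lam u) := by
  have := isMarkovKernel_tiltKernel μ hlam
  exact Measure.isProbabilityMeasure_map (by fun_prop)

lemma overshootLaw_real_Ici_zero (μ : Measure ℝ) [IsProbabilityMeasure μ] {lam : ℝ} (hlam : 0 < lam)
    {u : ℝ} (hu : tiltMass μ lam u ≠ 0) : (overshootLaw μ lam u).real (Set.Ici 0) = 1 := by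
  rw [overshootLaw_real_Ici μ hlam le_rfl hu, mul_zero, sub_zero, div_self]
  exact ENNReal.toReal_ne_zero.2 ⟨hu, tiltMass_ne_top μ hlam u⟩

lemma expMeasure_real_Ici {r : ℝ} (hr : 0 < r) (t : ℝ) :
    (expMeasure r).real (Set.Ici t) = if 0 ≤ t then Real.exp (-(r * t)) else 1 := by
  have := isProbabilityMeasure_expMeasure hr
  have hac : expMeasure r ≪ volume := withDensity_absolutelyContinuous _ _
  have hna : NullSingletonClass (expMeasure r) := ⟨fun x => hac (by simp)⟩
  have h1 := cdf_expMeasure_eq hr t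
  rw [cdf_eq_real] at h1
  have h2 : (expMeasure r).real (Set.Ici t) = (expMeasure r).real (Set.Ioi t) :=
    measureReal_congr Ioi_ae_eq_Ici.symm
  rw [h2, ← Set.compl_Iic, probReal_compl_eq_one_sub measurableSet_Iic, h1]
  split_ifs <;> ring

lemma eventually_tiltMass_ne_zero (μ : Measure ℝ) [IsProbabilityMeasure μ] {lam : ℝ}
    (hlam : lam ∈ Set.Ioo (0 : ℝ) 1)
    (hμ : (fun v => μ.real (Set.Ioi v)) ~[atTop] fun v => Real.exp (-v)) :
    ∀ᶠ u in atTop, tiltMass μ lam u ≠ 0 := by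
  obtain ⟨L, hL, hlim⟩ := exists_tendsto_exp_mul_integral_Iic μ hlam hμ
  filter_upwards [hlim.eventually (lt_mem_nhds hL)] with u hu
  rw [tiltMass_eq_ofReal μ hlam.1, ne_eq, ENNReal.ofReal_eq_zero, not_le]
  exact mul_pos (Real.exp_pos _) ((mul_pos_iff_of_pos_left (Real.exp_pos u)).1 hu)

/-- The rescaled overshoot below a high threshold is asymptotically exponential. -/
lemma tendsto_overshootLaw_real_Ici (μ : Measure ℝ) [IsProbabilityMeasure μ] {lam : ℝ}
    (hlam : lam ∈ Set.Ioo (0 : ℝ) 1)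
    (hμ : (fun v => μ.real (Set.Ioi v)) ~[atTop] fun v => Real.exp (-v)) (t : ℝ) :
    Tendsto (fun u => (overshootLaw μ lam u).real (Set.Ici t)) atTop
      (𝓝 ((expMeasure (1 - lam)).real (Set.Ici t))) := by
  rw [expMeasure_real_Ici (by linarith [hlam.2])]
  have hne := eventually_tiltMass_ne_zero μ hlam hμ
  split_ifs with ht
  · obtain ⟨L, hL, hlim⟩ := exists_tendsto_exp_mul_integral_Iic μ hlam hμ
    set I := fun u => ∫ v in Set.Iic u, Real.exp ((v - u) / lam) ∂μ with hI
    have hI0 : ∀ u, 0 ≤ I u := fun u => integral_nonneg fun v => (Real.exp_pos _).le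
    have hshift := hlim.comp (tendsto_atTop_add_const_right atTop (-(lam * t)) tendsto_id)
    -- The mass at `u` is `e^{u/λ} I u` with `e^u I u → L`, so lowering `u` by `λt` costs `e^{-t}`
    -- from the first factor and gains `e^{λt}` from `I`.
    have h3 := (hshift.div hlim hL.ne').const_mul (Real.exp (-((1 - lam) * t)))
    rw [div_self hL.ne', mul_one] at h3
    refine h3.congr' ?_
    filter_upwards [hne, hlim.eventually (lt_mem_nhds hL)] with u hu hu2
    have hIu : I u ≠ 0 := fun h => by
      change 0 < Real.exp u * I u at hu2
      rw [h, mul_zero] at hu2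
      exact lt_irrefl _ hu2
    rw [overshootLaw_real_Ici μ hlam.1 ht hu, tiltMass_eq_ofReal μ hlam.1,
      tiltMass_eq_ofReal μ hlam.1]
    change _ = (ENNReal.ofReal (_ * I _)).toReal / (ENNReal.ofReal (_ * I _)).toReal
    rw [ENNReal.toReal_ofReal (mul_nonneg (Real.exp_pos _).le (hI0 _)),
      ENNReal.toReal_ofReal (mul_nonneg (Real.exp_pos _).le (hI0 _))]
    change Real.exp _ * (Real.exp (u + -(lam * t)) * I (u + -(lam * t)) / (Real.exp u * I u)) = _
    rw [← sub_eq_add_neg, mul_div_mul_comm, mul_div_mul_comm, ← Real.exp_sub, ← Real.exp_sub,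
      ← mul_assoc, ← Real.exp_add]
    congr 2
    have := hlam.1.ne'
    field_simp
    ring
  · refine tendsto_const_nhds.congr' ?_
    filter_upwards [hne] with u hu
    have := isProbabilityMeasure_overshootLaw μ hlam.1 u
    refine le_antisymm ?_ measureReal_le_one
    rw [← overshootLaw_real_Ici_zero μ hlam.1 hu]
    exact measureReal_mono (Set.Ici_subset_Ici.2 (not_le.1 ht).le)

/-! ### The conditional law after adding an exponential shift -/

/-- The law of `y + (x - v)` with `v` drawn from the tilted law at `x - c` and `y` from `κ v`. -/
def mixtureKernel {d : ℕ} (μ : Measure ℝ) [IsFiniteMeasure μ] (κ : Kernel ℝ (Fin d → ℝ))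
    (lam c : ℝ) : Kernel ℝ (Fin d → ℝ) :=
  (Kernel.id ×ₖ (((tiltKernel μ lam).comap (fun x => x - c) (by fun_prop)) ⊗ₖ
    (Kernel.prodMkLeft ℝ κ))).map
    (fun p : ℝ × (ℝ × (Fin d → ℝ)) => fun l => p.2.2 l + (p.1 - p.2.1))

section

variable {d : ℕ} (μ : Measure ℝ) [IsFiniteMeasure μ] (κ : Kernel ℝ (Fin d → ℝ)) [IsMarkovKernel κ]
  {lam : ℝ} (c : ℝ)

lemma isMarkovKernel_mixtureKernel (hlam : 0 < lam) :
    IsMarkovKernel (mixtureKernel μ κ lam c) := by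
  have := isMarkovKernel_tiltKernel μ hlam
  exact Kernel.IsMarkovKernel.map _ (by fun_prop)

lemma lintegral_mixtureKernel (hlam : 0 < lam) (x : ℝ) {f : (Fin d → ℝ) → ENNReal}
    (hf : Measurable f) :
    ∫⁻ y, f y ∂(mixtureKernel μ κ lam c x) =
      ∫⁻ v, ∫⁻ y, f (fun l => y l + (x - v)) ∂(κ v) ∂(tiltKernel μ lam (x - c)) := by
  have := isMarkovKernel_tiltKernel μ hlam
  have hm : Measurable (fun p : ℝ × (ℝ × (Fin d → ℝ)) => fun l => p.2.2 l + (p.1 - p.2.1)) := by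
    fun_prop
  rw [mixtureKernel, Kernel.lintegral_map _ hm _ hf, 
    Kernel.lintegral_id_prod (f := fun p : ℝ × (ℝ × (Fin d → ℝ)) =>
      f fun l => p.2.2 l + (p.1 - p.2.1)) (hf.comp hm)]
  have hx : Measurable fun p : ℝ × (Fin d → ℝ) => f fun l => p.2 l + (x - p.1) :=
    (hf.comp hm).comp measurable_prodMk_left
  rw [Kernel.lintegral_compProd _ _ _ hx]
  simp [Kernel.comap_apply, Kernel.prodMkLeft_apply]

lemma measurable_shifted_prob (lam : ℝ) (a b : Fin d → ℝ → ℝ) (x : ℝ) (z : Fin d → ℝ) :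
    Measurable fun q => (κ (x - c - lam * q)).real
      {y | ∀ l, (y l + (lam * q + c) - a l x) / b l x ≤ z l} := by
  have hT : MeasurableSet {p : ℝ × (Fin d → ℝ) |
      ∀ l, (p.2 l + (lam * p.1 + c) - a l x) / b l x ≤ z l} := by
    simp only [Set.ofPred_forall]
    exact MeasurableSet.iInter fun l => measurableSet_le (by fun_prop) measurable_const
  exact (Kernel.measurable_kernel_prodMk_left
    (κ := κ.comap (fun q : ℝ => x - c - lam * q) (by fun_prop)) hT).ennreal_toReal

/-- The normalised conditional distribution function is an average over the overshoot. -/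
lemma normalizedCondCDF_mixtureKernel (hlam : 0 < lam) (a b : Fin d → ℝ → ℝ) (x : ℝ)
    (z : Fin d → ℝ) :
    normalizedCondCDF (mixtureKernel μ κ lam c) a b x z =
      ∫ q, (κ (x - c - lam * q)).real
        {y | ∀ l, (y l + (lam * q + c) - a l x) / b l x ≤ z l}
        ∂(overshootLaw μ lam (x - c)) := by
  have hS : MeasurableSet {y : Fin d → ℝ | ∀ l, (y l - a l x) / b l x ≤ z l} := by
    simp only [Set.ofPred_forall]
    exact MeasurableSet.iInter fun l => measurableSet_le (by fun_prop) measurable_const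
  have hq : Measurable fun v => (x - c - v) / lam := by fun_prop
  have hmeas := measurable_shifted_prob κ c lam a b x z
  rw [overshootLaw, integral_map hq.aemeasurable hmeas.aestronglyMeasurable,
    integral_eq_lintegral_of_nonneg_ae (ae_of_all _ fun _ => measureReal_nonneg)
      (hmeas.comp hq).aestronglyMeasurable, normalizedCondCDF, measureReal_def,
    ← lintegral_indicator_one hS,
    lintegral_mixtureKernel μ κ c hlam x (measurable_one.indicator hS)]
  congr 1
  refine lintegral_congr fun v => ?_
  have e1 : lam * ((x - c - v) / lam) = x - c - v := by field_simp
  have e2 : x - c - (x - c - v) = v := by ring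
  have e3 : x - c - v + c = x - v := by ring
  rw [ofReal_measureReal, e1, e2, e3]
  have hpre : MeasurableSet ((fun (y : Fin d → ℝ) l => y l + (x - v)) ⁻¹'
      {y : Fin d → ℝ | ∀ l, (y l - a l x) / b l x ≤ z l}) := hS.preimage (by fun_prop)
  exact lintegral_indicator_one hpre

end

/-- Substitution `q = (u - v) / λ` for the standard exponential law. -/
lemma lintegral_expMeasure_one_comp {lam : ℝ} (hlam : 0 < lam) (v : ℝ) {g : ℝ → ENNReal}
    (hg : Measurable g) :
    ∫⁻ q, g q ∂(expMeasure 1) =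
      ∫⁻ u, ENNReal.ofReal (lam⁻¹ * Real.exp (-u / lam)) *
        (tiltWeight lam u v * g ((u - v) / lam)) := by
  have hpdf : Measurable (exponentialPDF 1) := (measurable_exponentialPDFReal 1).ennreal_ofReal
  have h1 : ∫⁻ q, g q ∂(expMeasure 1) = ∫⁻ q, exponentialPDF 1 q * g q :=
    lintegral_withDensity_eq_lintegral_mul _ hpdf hg
  have hF : Measurable fun q => exponentialPDF 1 q * g q := hpdf.mul hg
  have h2 : ∫⁻ q, exponentialPDF 1 q * g q =
      ENNReal.ofReal lam⁻¹ * ∫⁻ u, exponentialPDF 1 (lam⁻¹ * u) * g (lam⁻¹ * u) := by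
    have hmap := Real.map_volume_mul_left (inv_ne_zero hlam.ne')
    rw [← lintegral_map hF (measurable_const_mul lam⁻¹), hmap, lintegral_smul_measure,
      smul_eq_mul, ← mul_assoc, ← ENNReal.ofReal_mul (by positivity), inv_inv,
      abs_of_pos hlam, inv_mul_cancel₀ hlam.ne', ENNReal.ofReal_one, one_mul]
  have h3 := lintegral_sub_right_eq_self (μ := volume)
    (fun u => exponentialPDF 1 (lam⁻¹ * u) * g (lam⁻¹ * u)) v
  rw [h1, h2, ← h3, ← lintegral_const_mul]
  · refine lintegral_congr fun u => ?_
    rw [← mul_assoc, ← mul_assoc, show lam⁻¹ * (u - v) = (u - v) / lam by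
      rw [div_eq_inv_mul]]
    congr 1
    rw [tiltWeight]
    split_ifs with huv
    · rw [exponentialPDF_of_nonneg (div_nonneg (sub_nonneg.2 huv) hlam.le),
        ← ENNReal.ofReal_mul (by positivity), ← ENNReal.ofReal_mul (by positivity), mul_assoc,
        ← Real.exp_add, one_mul, one_mul]
      congr 3
      ring
    · rw [exponentialPDF_of_neg (div_neg_of_neg_of_pos (sub_neg.2 (not_le.1 huv)) hlam), mul_zero,
        mul_zero]
  · exact hF.comp (f := fun u => lam⁻¹ * (u - v)) (by fun_prop)

/-- Disintegration along `u = X₀ - c`: substituting `q = (u-v)/λ` turns `e^{-q} dq` into `λ⁻¹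
e^{-u/λ} · e^{v/λ} 1{v ≤ u} du`. The tilting weight thus appears by Fubini, and its total mass
enters the density of `X₀`. -/
lemma lintegral_shifted_eq {Ω : Type*} [MeasurableSpace Ω] (P : Measure Ω)
    [IsProbabilityMeasure P] {d : ℕ} {V₀ : Ω → ℝ} {V : Ω → Fin d → ℝ} {Q : Ω → ℝ}
    (hV₀ : Measurable V₀) (hV : Measurable V) (hQ : Measurable Q)
    (κ : Kernel ℝ (Fin d → ℝ)) [IsMarkovKernel κ] (hκ : HasCondDistrib V V₀ κ P)
    (hQlaw : HasLaw Q (expMeasure 1) P) (hindep : IndepFun Q (fun ω => (V₀ ω, V ω)) P)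
    {lam : ℝ} (hlam : 0 < lam) (c : ℝ)
    {f : ℝ × (Fin d → ℝ) → ENNReal} (hf : Measurable f) :
    ∫⁻ ω, f (V₀ ω + lam * Q ω + c, fun l => V ω l + lam * Q ω + c) ∂P =
      ∫⁻ u, ENNReal.ofReal (lam⁻¹ * Real.exp (-u / lam)) * (tiltMass (P.map V₀) lam u *
        ∫⁻ y, f (u + c, y) ∂(mixtureKernel (P.map V₀) κ lam c (u + c))) := by
  have hprob := Measure.isProbabilityMeasure_map (μ := P) hV₀.aemeasurable
  set μ := P.map V₀ with hμ
  have hexp : IsProbabilityMeasure (expMeasure 1) := isProbabilityMeasure_expMeasure one_pos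
  have hjoint : P.map (fun ω => (Q ω, (V₀ ω, V ω))) = (expMeasure 1).prod (μ ⊗ₘ κ) := by
    rw [(indepFun_iff_map_prod_eq_prod_map_map hQ.aemeasurable
      (hV₀.prodMk hV).aemeasurable).1 hindep, hQlaw.map_eq]
    congr 1
    exact HasLaw.map_eq hκ
  have hF : Measurable fun p : ℝ × (ℝ × (Fin d → ℝ)) =>
      f (p.2.1 + lam * p.1 + c, fun l => p.2.2 l + lam * p.1 + c) :=
    hf.comp (by fun_prop)
  -- the inner integral over `κ v`
  let g : ℝ → ℝ → ENNReal := fun v s => ∫⁻ y, f (v + s, fun l => y l + s) ∂(κ v)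
  have hg : Measurable (Function.uncurry g) := by
    have h1 : Measurable fun p : (ℝ × ℝ) × (Fin d → ℝ) => f (p.1.1 + p.1.2, fun l => p.2 l + p.1.2) :=
      hf.comp (by fun_prop)
    exact Measurable.lintegral_kernel_prod_right'
      (κ := κ.comap (fun p : ℝ × ℝ => p.1) measurable_fst) h1
  calc ∫⁻ ω, f (V₀ ω + lam * Q ω + c, fun l => V ω l + lam * Q ω + c) ∂P
      = ∫⁻ p, f (p.2.1 + lam * p.1 + c, fun l => p.2.2 l + lam * p.1 + c)
          ∂((expMeasure 1).prod (μ ⊗ₘ κ)) := by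
        rw [← hjoint, lintegral_map hF (hQ.prodMk (hV₀.prodMk hV))]
    _ = ∫⁻ q, ∫⁻ v, g v (lam * q + c) ∂μ ∂(expMeasure 1) := by
        rw [lintegral_prod _ hF.aemeasurable]
        refine lintegral_congr fun q => ?_
        have hq : Measurable fun p : ℝ × (Fin d → ℝ) =>
            f (p.1 + lam * q + c, fun l => p.2 l + lam * q + c) := hf.comp (by fun_prop)
        rw [Measure.lintegral_compProd hq]
        simp only [g, add_assoc]
    _ = ∫⁻ v, ∫⁻ q, g v (lam * q + c) ∂(expMeasure 1) ∂μ := by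
        rw [lintegral_lintegral_swap]
        exact (hg.comp (f := fun p : ℝ × ℝ => (p.2, lam * p.1 + c)) (by fun_prop)).aemeasurable
    _ = ∫⁻ v, ∫⁻ u, ENNReal.ofReal (lam⁻¹ * Real.exp (-u / lam)) *
          (tiltWeight lam u v * g v (u - v + c)) ∂volume ∂μ := by
        refine lintegral_congr fun v => ?_
        rw [lintegral_expMeasure_one_comp hlam v (g := fun q => g v (lam * q + c))
          (hg.comp (f := fun q : ℝ => (v, lam * q + c)) (by fun_prop))]
        refine lintegral_congr fun u => ?_
        have : lam * ((u - v) / lam) = u - v := by field_simp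
        simp only [this]
    _ = ∫⁻ u, ∫⁻ v, ENNReal.ofReal (lam⁻¹ * Real.exp (-u / lam)) *
          (tiltWeight lam u v * g v (u - v + c)) ∂μ := by
        rw [lintegral_lintegral_swap]
        have h1 : Measurable fun p : ℝ × ℝ => tiltWeight lam p.2 p.1 :=
          (measurable_tiltWeight lam).comp measurable_swap
        have h2 : Measurable fun p : ℝ × ℝ => g p.1 (p.2 - p.1 + c) :=
          hg.comp (f := fun p : ℝ × ℝ => (p.1, p.2 - p.1 + c)) (by fun_prop)
        have h3 : Measurable fun p : ℝ × ℝ => ENNReal.ofReal (lam⁻¹ * Real.exp (-p.2 / lam)) := by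
          fun_prop
        exact (h3.mul (h1.mul h2)).aemeasurable
    _ = _ := by
        refine lintegral_congr fun u => ?_
        have h2 : Measurable fun v : ℝ => g v (u - v + c) :=
          hg.comp (f := fun v : ℝ => (v, u - v + c)) (by fun_prop)
        have h3 : Measurable fun v => tiltWeight lam u v * g v (u - v + c) :=
          (measurable_tiltWeight_right lam u).mul h2
        rw [lintegral_const_mul _ h3, ← tiltMass_mul_lintegral_tiltKernel μ hlam u h2,
          lintegral_mixtureKernel μ κ c hlam _ (f := fun y => f (u + c, y))
            (hf.comp measurable_prodMk_left), add_sub_cancel_right]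
        congr 2
        refine lintegral_congr fun v => lintegral_congr fun y => ?_
        have e1 : v + (u - v + c) = u + c := by ring
        have e2 : u + c - v = u - v + c := by ring
        simp only [e1, e2]

/-- `mixtureKernel` is a version of the conditional law of the shifted vector. -/
lemma hasCondDistrib_mixtureKernel {Ω : Type*} [MeasurableSpace Ω] (P : Measure Ω)
    [IsProbabilityMeasure P] {d : ℕ} {V₀ : Ω → ℝ} {V : Ω → Fin d → ℝ} {Q : Ω → ℝ}
    (hV₀ : Measurable V₀) (hV : Measurable V) (hQ : Measurable Q)
    (κ : Kernel ℝ (Fin d → ℝ)) [IsMarkovKernel κ] (hκ : HasCondDistrib V V₀ κ P)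
    (hQlaw : HasLaw Q (expMeasure 1) P) (hindep : IndepFun Q (fun ω => (V₀ ω, V ω)) P)
    {lam : ℝ} (hlam : 0 < lam) (c : ℝ) :
    HasCondDistrib (fun ω l => V ω l + lam * Q ω + c) (fun ω => V₀ ω + lam * Q ω + c)
      (mixtureKernel (P.map V₀) κ lam c) P := by
  have hX₀ : Measurable fun ω => V₀ ω + lam * Q ω + c := by fun_prop
  have hX : Measurable fun ω l => V ω l + lam * Q ω + c := by fun_prop
  have hmk := isMarkovKernel_mixtureKernel (P.map V₀) κ c hlam
  refine ⟨(hX₀.prodMk hX).aemeasurable, Measure.ext_of_lintegral _ fun f hf => ?_⟩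
  have hg : Measurable fun x => ∫⁻ y, f (x, y) ∂(mixtureKernel (P.map V₀) κ lam c x) :=
    Measurable.lintegral_kernel_prod_right' hf
  -- The disintegration is used twice, for `f` and for its average over the kernel; the average no
  -- longer depends on `y`, so the Markov property makes the two sides equal.
  rw [lintegral_map hf (hX₀.prodMk hX), Measure.lintegral_compProd hf, lintegral_map hg hX₀,
    lintegral_shifted_eq P hV₀ hV hQ κ hκ hQlaw hindep hlam c hf,
    lintegral_shifted_eq P hV₀ hV hQ κ hκ hQlaw hindep hlam c
      (f := fun p => ∫⁻ y, f (p.1, y) ∂(mixtureKernel (P.map V₀) κ lam c p.1))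
      (hg.comp measurable_fst)]
  simp

/-! ### Convergence of the conditional distribution functions -/

section

variable {d : ℕ} {a b : Fin d → ℝ → ℝ} {α β : Fin d → ℝ} {κ : Kernel ℝ (Fin d → ℝ)}
  [IsMarkovKernel κ] {G : (Fin d → ℝ) → ℝ}

lemma monotone_normalizedCondCDF (κ : Kernel ℝ (Fin d → ℝ)) [IsMarkovKernel κ]
    (a b : Fin d → ℝ → ℝ) (v : ℝ) : Monotone (normalizedCondCDF κ a b v) :=
  fun _ _ hyz => measureReal_mono fun _ hw l => (hw l).trans (hyz l)

lemma ConvergesWithPartials.tendsto_update {F : ℝ → (Fin d → ℝ) → ℝ}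
    (hG : ConvergesWithPartials F G) (z : Fin d → ℝ) (k : Fin d) :
    Tendsto (fun t : ℝ => G (Function.update z k (z k + t))) (𝓝 0) (𝓝 (G z)) :=
  (((hG.differentiable_limit z).1 k).self_of_nhds).tendsto_update

lemma ConvergesWithPartials.continuous_limit
    (hG : ConvergesWithPartials (normalizedCondCDF κ a b) G) : Continuous G :=
  continuous_of_monotone_of_tendsto_update
    (fun y z hyz => le_of_tendsto_of_tendsto' (hG.tendsto y) (hG.tendsto z)
      fun v => monotone_normalizedCondCDF κ a b v hyz) hG.tendsto_update

/-- The integrand of the overshoot representation converges continuously. -/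
lemma tendsto_shifted_prob (hab : ∀ l, RegularNormalization (a l) (b l) (α l))
    (hβ : ∀ l, Tendsto (fun x => (b l x)⁻¹) atTop (𝓝 (β l)))
    (hG : ConvergesWithPartials (normalizedCondCDF κ a b) G) (lam c : ℝ) (z : Fin d → ℝ) (q : ℝ) :
    Tendsto (fun p : ℝ × ℝ => (κ (p.1 - c - lam * p.2)).real
      {y | ∀ l, (y l + (lam * p.2 + c) - a l p.1) / b l p.1 ≤ z l}) (atTop ×ˢ 𝓝 q)
      (𝓝 (G (z + fun l => (α l - 1) * (lam * q + c) * β l))) := by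
  have hs : Tendsto (fun p : ℝ × ℝ => (p.1, lam * p.2 + c)) (atTop ×ˢ 𝓝 q)
      (atTop ×ˢ 𝓝 (lam * q + c)) :=
    tendsto_fst.prodMk ((tendsto_snd.const_mul lam).add_const c)
  have hv := (tendsto_fst_sub_snd_atTop (lam * q + c)).comp hs
  have hζ := (tendsto_pi_nhds.2 fun l =>
    (hab l).tendsto_shifted_argument (hβ l) (z l) (lam * q + c)).comp hs
  have hF := tendsto_prod_nhds_of_monotone (monotone_normalizedCondCDF κ a b) hG.tendsto
    hG.tendsto_update (z + fun l => (α l - 1) * (lam * q + c) * β l)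
  refine (hF.comp (hv.prodMk hζ)).congr' ?_
  have hb1 : ∀ᶠ p : ℝ × ℝ in atTop ×ˢ 𝓝 q, ∀ l, 0 < b l p.1 :=
    tendsto_fst.eventually (eventually_all.2 fun l => (hab l).pos_b)
  have hb2 := hv.eventually (eventually_all.2 fun l => (hab l).pos_b)
  filter_upwards [hb1, hb2] with p hp1 hp2
  simp only [Function.comp] at hp2 ⊢
  have e : p.1 - c - lam * p.2 = p.1 - (lam * p.2 + c) := by ring
  rw [normalizedCondCDF, e]
  congr 1
  ext y
  simp only [Set.mem_ofPred_eq]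
  refine forall_congr' fun l => ?_
  rw [div_le_div_iff_of_pos_right (hp2 l), div_le_iff₀ (hp1 l)]
  constructor <;> intro h <;> linarith [mul_comm (z l) (b l p.1)]

/-- Convergence of the normalised conditional distribution functions of the mixture. -/
lemma tendsto_normalizedCondCDF_mixtureKernel (μ : Measure ℝ) [IsProbabilityMeasure μ]
    (hμ : (fun v => μ.real (Set.Ioi v)) ~[atTop] fun v => Real.exp (-v))
    (hab : ∀ l, RegularNormalization (a l) (b l) (α l))
    (hβ : ∀ l, Tendsto (fun x => (b l x)⁻¹) atTop (𝓝 (β l)))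
    (hG : ConvergesWithPartials (normalizedCondCDF κ a b) G)
    {lam : ℝ} (hlam : lam ∈ Set.Ioo (0 : ℝ) 1) (c : ℝ) (z : Fin d → ℝ) :
    Tendsto (fun x => normalizedCondCDF (mixtureKernel μ κ lam c) a b x z) atTop
      (𝓝 (∫ q, G (z + fun l => (α l - 1) * (lam * q + c) * β l) ∂(expMeasure (1 - lam)))) := by
  have h1 : IsProbabilityMeasure (expMeasure (1 - lam)) :=
    isProbabilityMeasure_expMeasure (by linarith [hlam.2])
  simp only [normalizedCondCDF_mixtureKernel μ κ c hlam.1]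
  refine tendsto_integral_of_continuous_convergence
    (ν := fun x => ⟨overshootLaw μ lam (x - c), isProbabilityMeasure_overshootLaw μ hlam.1 _⟩)
    (ν₀ := ⟨expMeasure (1 - lam), h1⟩) ?_
    (h := fun x q => (κ (x - c - lam * q)).real
      {y | ∀ l, (y l + (lam * q + c) - a l x) / b l x ≤ z l})
    (fun x => measurable_shifted_prob κ c lam a b x z)
    (fun x q => by rw [abs_of_nonneg measureReal_nonneg]; exact measureReal_le_one)
    (hG.continuous_limit.comp (by fun_prop)) (tendsto_shifted_prob hab hβ hG lam c z)
  exact tendsto_probabilityMeasure_of_tendsto_Ici fun t =>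
    (tendsto_overshootLaw_real_Ici μ hlam hμ t).comp (tendsto_atTop_add_const_right _ _ tendsto_id)

/-- If for large `x` the shifted event forces some coordinate below a level that is almost surely
exceeded, then the limiting integrand vanishes. -/
lemma limit_eq_zero_of_eventually_le (μ : Measure ℝ) [IsProbabilityMeasure μ]
    (hμ : (fun v => μ.real (Set.Ioi v)) ~[atTop] fun v => Real.exp (-v))
    (hab : ∀ l, RegularNormalization (a l) (b l) (α l))
    (hβ : ∀ l, Tendsto (fun x => (b l x)⁻¹) atTop (𝓝 (β l)))
    (hG : ConvergesWithPartials (normalizedCondCDF κ a b) G)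
    {lam : ℝ} (hlam : lam ∈ Set.Ioo (0 : ℝ) 1) (c : ℝ) (z : Fin d → ℝ) {r q₁ q₀ : ℝ}
    (hq₁ : 0 ≤ q₁) (hq : q₁ < q₀) (hr : ∀ l, ∀ᵐ v ∂μ, κ v {y | y l ≤ r} = 0)
    (hx : ∀ᶠ x in atTop, ∃ l, a l x + b l x * z l ≤ r + (lam * q₁ + c)) :
    G (z + fun l => (α l - 1) * (lam * q₀ + c) * β l) = 0 := by
  have hconv := tendsto_shifted_prob hab hβ hG lam c z q₀
  have hg0 : 0 ≤ G (z + fun l => (α l - 1) * (lam * q₀ + c) * β l) :=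
    ge_of_tendsto' hconv fun p => measureReal_nonneg
  by_contra hne
  have hpos := lt_of_le_of_ne hg0 (Ne.symm hne)
  -- If the limit were positive, continuous convergence would make the integrand positive for all
  -- large `x` and all `q` within `ε` of `q₀`. The window `[A, D)` below lies in that range and
  -- above `q₁`.
  obtain ⟨pa, hpa, pb, hpb, hp⟩ := eventually_prod_iff.1 (hconv.eventually (lt_mem_nhds hpos))
  obtain ⟨ε, hε, hball⟩ := Metric.eventually_nhds_iff.1 hpb
  set A := max q₁ (q₀ - ε / 2) with hA
  set D := q₀ + ε / 2 with hD
  have hA0 : 0 ≤ A := hq₁.trans (le_max_left _ _)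
  have hAD : A < D := max_lt (by linarith) (by linarith)
  have hlim : Tendsto (fun x => (overshootLaw μ lam (x - c)).real (Set.Ici A) -
      (overshootLaw μ lam (x - c)).real (Set.Ici D)) atTop
      (𝓝 (Real.exp (-((1 - lam) * A)) - Real.exp (-((1 - lam) * D)))) := by
    have h1 := fun t => (tendsto_overshootLaw_real_Ici μ hlam hμ t).comp
      (tendsto_atTop_add_const_right atTop (-c) tendsto_id)
    have h2 := (h1 A).sub (h1 D)
    rwa [expMeasure_real_Ici (by linarith [hlam.2]), expMeasure_real_Ici (by linarith [hlam.2]),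
      if_pos hA0, if_pos (hA0.trans hAD.le)] at h2
  have hgap : 0 < Real.exp (-((1 - lam) * A)) - Real.exp (-((1 - lam) * D)) := by
    rw [sub_pos, Real.exp_lt_exp]
    have := mul_lt_mul_of_pos_left hAD (show 0 < 1 - lam by linarith [hlam.2])
    linarith
  have hmass := (tendsto_atTop_add_const_right atTop (-c) tendsto_id).eventually
    (eventually_tiltMass_ne_zero μ hlam hμ)
  have hb : ∀ᶠ x in atTop, ∀ l, 0 < b l x := eventually_all.2 fun l => (hab l).pos_b
  obtain ⟨x, hx1, hx2, hx3, hx4, hxb⟩ := ((hlim.eventually (lt_mem_nhds hgap)).and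
    (hpa.and (hmass.and (hx.and hb)))).exists
  obtain ⟨l, hl⟩ := hx4
  have := isProbabilityMeasure_overshootLaw μ hlam.1 (x - c)
  rw [← measureReal_sdiff (Set.Ici_subset_Ici.2 hAD.le) measurableSet_Ici, Set.Ici_sdiff_Ici]
    at hx1
  refine hx1.ne' ?_
  rw [overshootLaw, map_measureReal_apply (by fun_prop) measurableSet_Ico, measureReal_def,
    ENNReal.toReal_eq_zero_iff]
  -- The exponential limit charges the window, hence so does the overshoot law for large `x`. Yet
  -- the window is null: its `v` have a positive integrand, whereas for almost every `v` the event
  -- lies in the null set `{y | y l ≤ r}`.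
  left
  have hae : ∀ᵐ v ∂(tiltKernel μ lam (x - c)), κ v {y | y l ≤ r} = 0 :=
    (tiltKernel_absolutelyContinuous μ hx3).ae_le (hr l)
  refine measure_mono_null (t := {v | κ v {y | y l ≤ r} = 0}ᶜ) ?_ hae
  intro v hv hzero
  have hzero : κ v {y | y l ≤ r} = 0 := hzero
  obtain ⟨hv1, hv2⟩ : A ≤ (x - c - v) / lam ∧ (x - c - v) / lam < D := hv
  have hq1 : q₁ ≤ (x - c - v) / lam := (le_max_left _ _).trans hv1
  have hq2 : q₀ - ε / 2 ≤ (x - c - v) / lam := (le_max_right _ _).trans hv1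
  have h0 := hp hx2 (hball (y := (x - c - v) / lam) (by
    rw [Real.dist_eq, abs_lt]; constructor <;> linarith))
  have e1 : lam * ((x - c - v) / lam) = x - c - v := by have := hlam.1.ne'; field_simp
  simp only [e1, sub_sub_cancel] at h0
  refine h0.ne' ?_
  rw [measureReal_def, ENNReal.toReal_eq_zero_iff]
  left
  refine measure_mono_null (fun y hy => ?_) hzero
  have h1 := hy l
  rw [div_le_iff₀ (hxb l)] at h1
  have h2 : lam * q₁ ≤ x - c - v := by
    rw [← e1]; exact mul_le_mul_of_nonneg_left hq1 hlam.1.le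
  show y l ≤ r
  linarith [mul_comm (z l) (b l x)]

end

/-! ### The lower endpoint -/

section

variable {Ω : Type*} [MeasurableSpace Ω] (P : Measure Ω) {d : ℕ}
  (V₀ : Ω → ℝ) (V : Ω → Fin d → ℝ)

lemma lowerEndpoint_ne_top [IsProbabilityMeasure P] : lowerEndpoint P V₀ V ≠ ⊤ := by
  intro htop
  have h0 : ∀ n : ℕ, P {ω | V₀ ω ≤ n} = 0 := fun n => by
    by_contra hn
    have hle : lowerEndpoint P V₀ V ≤ ((n : ℝ) : EReal) :=
      sInf_le ⟨(n : ℝ), Or.inl (pos_iff_ne_zero.2 hn), rfl⟩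
    rw [htop, top_le_iff] at hle
    exact EReal.coe_ne_top _ hle
  have h1 : P (⋃ n : ℕ, {ω | V₀ ω ≤ n}) = 0 := measure_iUnion_null h0
  have h2 : (⋃ n : ℕ, {ω | V₀ ω ≤ n}) = Set.univ := Set.eq_univ_of_forall fun ω => by
    obtain ⟨n, hn⟩ := exists_nat_ge (V₀ ω)
    exact Set.mem_iUnion.2 ⟨n, hn⟩
  rw [h2, measure_univ] at h1
  exact one_ne_zero h1

variable {P V₀ V}

lemma measure_le_eq_zero_of_lt_lowerEndpoint {r : ℝ} (hr : (r : EReal) < lowerEndpoint P V₀ V)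
    (l : Fin d) : P {ω | V ω l ≤ r} = 0 := by
  by_contra hne
  exact hr.not_ge (sInf_le ⟨r, Or.inr ⟨l, pos_iff_ne_zero.2 hne⟩, rfl⟩)

lemma ae_condLaw_le_eq_zero [IsProbabilityMeasure P] (hV₀ : Measurable V₀) (hV : Measurable V) {κ : Kernel ℝ (Fin d → ℝ)}
    [IsMarkovKernel κ] (hκ : HasCondDistrib V V₀ κ P) {r : ℝ} {l : Fin d}
    (h : P {ω | V ω l ≤ r} = 0) : ∀ᵐ v ∂(P.map V₀), κ v {y | y l ≤ r} = 0 := by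
  have hS : MeasurableSet {y : Fin d → ℝ | y l ≤ r} :=
    measurableSet_le (measurable_pi_apply l) measurable_const
  have h1 : (P.map V₀ ⊗ₘ κ) (Prod.snd ⁻¹' {y | y l ≤ r}) = 0 := by
    have he : P.map (fun ω => (V₀ ω, V ω)) = P.map V₀ ⊗ₘ κ := HasLaw.map_eq hκ
    rw [← he, Measure.map_apply (hV₀.prodMk hV) (measurable_snd hS)]
    exact h
  rw [Measure.compProd_apply (measurable_snd hS),
    lintegral_eq_zero_iff (Kernel.measurable_kernel_prodMk_left (measurable_snd hS))] at h1
  exact h1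

/-- Unfolding the bound gives `min (min_l …) x < w + λq + log(1-λ)`; for `x` above that level the
minimum is attained by a coordinate, not by `x`. -/
lemma exists_le_of_qBound_lt [NeZero d] {lam : ℝ} (hlam : 0 < lam) {a b : Fin d → ℝ → ℝ}
    {z : Fin d → ℝ} {x w q : ℝ} (hq : qBound lam (w : EReal) a b z x < (q : EReal))
    (hx : w + (lam * q + Real.log (1 - lam)) < x) :
    ∃ l, a l x + b l x * z l ≤ w + (lam * q + Real.log (1 - lam)) := by
  have h1 := (le_max_right _ _).trans_lt hq
  rw [← EReal.coe_sub, ← EReal.coe_add, ← EReal.coe_div, EReal.coe_lt_coe_iff,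
    div_lt_iff₀ hlam] at h1
  have h2 : min (⨅ l, (a l x + b l x * z l)) x < w + (lam * q + Real.log (1 - lam)) := by linarith
  rcases min_lt_iff.1 h2 with h3 | h3
  · obtain ⟨l, hl⟩ := exists_lt_of_ciInf_lt h3
    exact ⟨l, hl.le⟩
  · exact absurd h3 hx.not_gt

lemma qBound_bot {lam : ℝ} (hlam : 0 < lam) (a b : Fin d → ℝ → ℝ) (z : Fin d → ℝ) (x : ℝ) :
    qBound lam ⊥ a b z x = ⊤ := by
  rw [qBound, EReal.coe_sub_bot, EReal.top_add_coe, EReal.top_div_of_pos_ne_top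
    (EReal.coe_pos.2 hlam) (EReal.coe_ne_top _)]
  simp

end

/-! ### The limiting integral -/

lemma integral_expMeasure_eq_setIntegral {r : ℝ} (hr : 0 < r) {g : ℝ → ℝ} {qstar : EReal}
    (hg : ∀ q : ℝ, 0 ≤ q → qstar < q → g q = 0) :
    ∫ q, g q ∂(expMeasure r) =
      ∫ q in {q : ℝ | 0 ≤ q ∧ (q : EReal) ≤ qstar}, g q * (r * Real.exp (-r * q)) := by
  have hS : MeasurableSet {q : ℝ | 0 ≤ q ∧ (q : EReal) ≤ qstar} :=
    (measurableSet_le measurable_const measurable_id).inter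
      (measurableSet_le measurable_coe_real_ereal measurable_const)
  have hpdf : Measurable (exponentialPDF r) := (measurable_exponentialPDFReal r).ennreal_ofReal
  have h1 : ∫ q, g q ∂(expMeasure r) = ∫ q, (exponentialPDF r q).toReal • g q :=
    integral_withDensity_eq_integral_toReal_smul hpdf (ae_of_all _ fun _ => ENNReal.ofReal_lt_top) g
  rw [h1, ← integral_indicator hS]
  refine integral_congr_ae (ae_of_all _ fun q => ?_)
  simp only [Set.indicator_apply, Set.mem_ofPred_eq, smul_eq_mul]
  by_cases hq : 0 ≤ q
  · rw [exponentialPDF_of_nonneg hq, ENNReal.toReal_ofReal (by positivity)]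
    by_cases hq2 : (q : EReal) ≤ qstar
    · rw [if_pos ⟨hq, hq2⟩, neg_mul, mul_comm]
    · rw [if_neg fun h => hq2 h.2, hg q hq (not_le.1 hq2), mul_zero]
  · rw [exponentialPDF_of_neg (not_le.1 hq), if_neg fun h => hq h.1]
    simp

lemma limitShift_eq {d : ℕ} (lam : ℝ) (α : Fin d → ℝ) (B : Fin d → EReal) (q : ℝ) :
    limitShift lam α B q =
      fun l => (α l - 1) * (lam * q + Real.log (1 - lam)) * ((B l)⁻¹).toReal := by
  ext l
  rw [limitShift, EReal.div_eq_inv_mul, EReal.toReal_mul, EReal.toReal_coe, mul_comm]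

lemma tendsto_inv_of_tendsto_ereal {b : ℝ → ℝ} {B : EReal} (hB : 0 < B)
    (hb : Tendsto (fun x => (b x : EReal)) atTop (𝓝 B)) :
    Tendsto (fun x => (b x)⁻¹) atTop (𝓝 (B⁻¹).toReal) := by
  induction B with
  | bot => exact absurd hB (by simp)
  | top =>
    rw [EReal.inv_top, EReal.toReal_zero]
    exact (EReal.tendsto_coe_nhds_top_iff.1 hb).inv_tendsto_atTop
  | coe B =>
    rw [← EReal.coe_inv, EReal.toReal_coe]
    exact (EReal.tendsto_coe.1 hb).inv₀ (EReal.coe_pos.1 hB).ne'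

end

/-- `κ` is a version of the conditional law of `V` given `V₀`, and `κX` one of `X` given `X₀`;
any two versions agree almost everywhere with respect to the law of the conditioning variable. -/
theorem proposition1 {Ω : Type*} [MeasurableSpace Ω] (P : Measure Ω) [IsProbabilityMeasure P]
    {d : ℕ} [NeZero d]
    (V₀ : Ω → ℝ) (V : Ω → Fin d → ℝ) (Q : Ω → ℝ)
    (hV₀ : Measurable V₀) (hV : Measurable V) (hQ : Measurable Q)
    -- exponential-tailed margins
    (htail₀ : (fun v : ℝ => P.real {ω | v < V₀ ω}) ~[atTop] fun v => Real.exp (-v))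
    (htail : ∀ l, (fun v : ℝ => P.real {ω | v < V ω l}) ~[atTop] fun v => Real.exp (-v))
    -- the normalisation, and the conditional limit with its partial derivatives
    (a b : Fin d → ℝ → ℝ) (α : Fin d → ℝ)
    (hab : ∀ l, RegularNormalization (a l) (b l) (α l))
    (κ : Kernel ℝ (Fin d → ℝ)) [IsMarkovKernel κ] (hκ : HasCondDistrib V V₀ κ P)
    (G : (Fin d → ℝ) → ℝ)
    (hG : ConvergesWithPartials (normalizedCondCDF κ a b) G)
    -- the mixing variable
    (hQlaw : HasLaw Q (expMeasure 1) P)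
    (hindep : IndepFun Q (fun ω => (V₀ ω, V ω)) P)
    (lam : ℝ) (hlam : lam ∈ Set.Ioo (0 : ℝ) 1)
    (X₀ : Ω → ℝ) (hX₀ : ∀ ω, X₀ ω = V₀ ω + lam * Q ω + Real.log (1 - lam))
    (X : Ω → Fin d → ℝ) (hX : ∀ ω l, X ω l = V ω l + lam * Q ω + Real.log (1 - lam)) :
    ∃ κX : Kernel ℝ (Fin d → ℝ), IsMarkovKernel κX ∧ HasCondDistrib X X₀ κX P ∧
      (Tendsto (fun x => ⨅ l, b l x) atTop atTop →
        ∀ z, Tendsto (fun x => normalizedCondCDF κX a b x z) atTop (𝓝 (G z))) ∧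
      (¬ Tendsto (fun x => ⨅ l, b l x) atTop atTop →
        ∀ B : Fin d → EReal,
          (∀ l, 0 < B l ∧ Tendsto (fun x => (b l x : EReal)) atTop (𝓝 (B l))) →
        ∀ (z : Fin d → ℝ) (qstar : EReal),
          Tendsto (qBound lam (lowerEndpoint P V₀ V) a b z) atTop (𝓝 qstar) →
          Tendsto (fun x => normalizedCondCDF κX a b x z) atTop
            (𝓝 (∫ q in {q : ℝ | 0 ≤ q ∧ (q : EReal) ≤ qstar},
              G (z + limitShift lam α B q) *
                ((1 - lam) * Real.exp (-(1 - lam) * q))))) := by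
  have hlam1 : 0 < 1 - lam := by linarith [hlam.2]
  have hprob : IsProbabilityMeasure (P.map V₀) := Measure.isProbabilityMeasure_map hV₀.aemeasurable
  have hexp : IsProbabilityMeasure (expMeasure (1 - lam)) := isProbabilityMeasure_expMeasure hlam1
  have hμ : (fun v => (P.map V₀).real (Set.Ioi v)) ~[atTop] fun v => Real.exp (-v) := by
    have e : (fun v => (P.map V₀).real (Set.Ioi v)) = fun v : ℝ => P.real {ω | v < V₀ ω} := by
      ext v
      rw [map_measureReal_apply hV₀ measurableSet_Ioi]
      rfl
    rw [e]
    exact htail₀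
  obtain rfl : X₀ = fun ω => V₀ ω + lam * Q ω + Real.log (1 - lam) := funext hX₀
  obtain rfl : X = fun ω l => V ω l + lam * Q ω + Real.log (1 - lam) :=
    funext fun ω => funext (hX ω)
  refine ⟨mixtureKernel (P.map V₀) κ lam (Real.log (1 - lam)),
    isMarkovKernel_mixtureKernel _ κ _ hlam.1,
    hasCondDistrib_mixtureKernel P hV₀ hV hQ κ hκ hQlaw hindep hlam.1 _, ?_, ?_⟩
  · intro hb z
    have hβ : ∀ l, Tendsto (fun x => (b l x)⁻¹) atTop (𝓝 0) := fun l =>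
      (tendsto_atTop_mono (fun x => ciInf_le (Set.finite_range _).bddBelow l) hb).inv_tendsto_atTop
    have h := tendsto_normalizedCondCDF_mixtureKernel (P.map V₀) hμ hab (β := fun _ => 0) hβ hG
      hlam (Real.log (1 - lam)) z
    have e : (fun l : Fin d => (0 : ℝ)) = 0 := rfl
    simpa [e] using h
  · intro _ B hB z qstar hqstar
    have hβ : ∀ l, Tendsto (fun x => (b l x)⁻¹) atTop (𝓝 ((B l)⁻¹).toReal) := fun l =>
      tendsto_inv_of_tendsto_ereal (hB l).1 (hB l).2
    have h := tendsto_normalizedCondCDF_mixtureKernel (P.map V₀) hμ hab hβ hG hlam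
      (Real.log (1 - lam)) z
    simp only [← limitShift_eq] at h
    rwa [integral_expMeasure_eq_setIntegral hlam1 (qstar := qstar)] at h
    intro q _ hq
    have hqs0 : 0 ≤ qstar := ge_of_tendsto' hqstar fun x => le_max_left _ _
    -- The bound only tends to `qstar`; it is eventually below the intermediate `q₂`, and the gap `q
    -- - q₂` remains available.
    obtain ⟨q₂, hq₂, hq₂'⟩ := EReal.lt_iff_exists_real_btwn.1 hq
    have hq₂q : q₂ < q := EReal.coe_lt_coe_iff.1 hq₂'
    have hq₂0 : 0 < q₂ := EReal.coe_pos.1 (hqs0.trans_lt hq₂)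
    have hbound := hqstar.eventually (gt_mem_nhds hq₂)
    generalize hvs : lowerEndpoint P V₀ V = vs at hbound
    induction vs with
    | bot =>
      -- For `v_* = -∞` the bound is identically `⊤`, so nothing is truncated.
      obtain ⟨x, hx⟩ := hbound.exists
      rw [qBound_bot hlam.1] at hx
      exact absurd hx not_top_lt
    | top => exact absurd hvs (lowerEndpoint_ne_top P V₀ V)
    | coe w =>
      have hmid : 0 < lam * ((q - q₂) / 2) := mul_pos hlam.1 (by linarith)
      rw [limitShift_eq]
      -- Half of the gap puts `r` strictly below `v_* = w`, so that `V l ≤ r` is null; the other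
      -- half puts `q₁` strictly below `q`. The choices balance: `r + λq₁ = w + λq₂`.
      refine limit_eq_zero_of_eventually_le (P.map V₀) hμ hab hβ hG hlam _ z
        (r := w - lam * ((q - q₂) / 2)) (q₁ := (q + q₂) / 2) (by linarith) (by linarith) ?_ ?_
      · intro l
        refine ae_condLaw_le_eq_zero hV₀ hV hκ (measure_le_eq_zero_of_lt_lowerEndpoint
          (P := P) (V₀ := V₀) ?_ l)
        rw [hvs, EReal.coe_lt_coe_iff]
        linarith
      · filter_upwards [hbound,
          eventually_gt_atTop (w + (lam * q₂ + Real.log (1 - lam)))] with x hx1 hx2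
        obtain ⟨l, hl⟩ := exists_le_of_qBound_lt hlam.1 hx1 hx2
        exact ⟨l, hl.trans_eq (by ring)⟩
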